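/- **Theorem 2.1.** Let $X_0=0$ and $X_t=g(X_{t-1})+u_t$ for $t\ge 1$, with $g:\mathbb R\to\mathbb R$, on a probability space, and assume the null hypothesis $H_0$: $P(g(X_{t-1})=X_{t-1})=1$ for all $t\ge1$. Assume the following. (i) $u_1,u_2,\dots$ are independent and identically distributed with $E[u_1]=0$, $\sigma_u^2=E[u_1^2]<\infty$ (where $\sigma_u\ge 0$) and $0<E[u_1^4]<\infty$. (ii) $u_1$ has a symmetric, continuously differentiable density, and its characteristic function $\psi$ satisfies $\int_{-\infty}^{\infty}|v|\,|\psi(v)|\,dv<\infty$. (iii) $K$ is a symmetric probability density on $\mathbb R$; there are constants $c_1>0$ and $0<c_2<c_3<\infty$ with $c_2 I(|x|\le c_1)\le K(x)\le c_3 I(|x|\le c_1)$ for all $x$; and there is a nonnegative bounded function $\Psi$ on the compact support $C(K)$ of $K$ such that for every $x\in C(K)$ one has $|K(x+y)-K(x)|\le\Psi(x)|y|$ for all sufficiently small $y$ with $x+y\in C(K)$. (iv) The bandwidths $h=h_T>0$ satisfy $\lim_{T\to\infty}T^{3/10}h=0$ and $\limsup_{T\to\infty}T^{1/2-\varepsilon_0}h=\infty$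 for all $0<\varepsilon_0<\frac15$. Then for every $T$ $$\sigma_T^2=E\left(\sum_{t=1}^T\ \sum_{s=1,\,s\ne t}^T u_s\,K\!\left(\frac{X_{t-1}-X_{s-1}}{h}\right)u_t\right)^2$$ is finite, and $$\sigma_T^2=C_{10}\,T^{3/2}\,h\,(1+o(1))\quad\text{as }T\to\infty,\qquad C_{10}=\frac{16\,\sigma_u^3\int_{-\infty}^{\infty}K^2(x)\,dx}{3\sqrt{2\pi}} .$$ -/

import Mathlib

open MeasureTheory ProbabilityTheory Filter Topology Asymptotics

namespace KernelUnitRoot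

/-- Assumptions on the errors `u 1, u 2, …` (the value `u 0` plays no role).
They are i.i.d. with mean zero and finite, nonzero fourth moment, and have a symmetric,
continuously differentiable density `f`; the characteristic function `ψ` of their law satisfies
`∫ |v| |ψ v| dv < ∞`. -/
structure ErrorAssumption {Ω : Type*} [MeasurableSpace Ω] (P : Measure Ω)
    (u : ℕ → Ω → ℝ) : Prop where
  measurable : ∀ t, 1 ≤ t → Measurable (u t)
  indep : iIndepFun (fun t : ℕ => u (t + 1)) P
  identDistrib : ∀ t, 1 ≤ t → IdentDistrib (u t) (u 1) P P
  memLp_four : MemLp (u 1) 4 P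
  mean_zero : ∫ ω, u 1 ω ∂P = 0
  fourth_moment_pos : 0 < ∫ ω, (u 1 ω) ^ 4 ∂P
  density : ∃ f : ℝ → ℝ,
    (∀ x, 0 ≤ f x) ∧
    (∀ x, f (-x) = f x) ∧
    Differentiable ℝ f ∧ Continuous (deriv f) ∧
    P.map (u 1) = volume.withDensity (fun x => ENNReal.ofReal (f x))
  charFun_integrable : Integrable (fun v : ℝ => |v| * ‖charFun (P.map (u 1)) v‖) volume

/-- Assumptions on the kernel `K`: a symmetric probability density, bounded above and bounded away
from zero on an interval `[-c₁, c₁]` and vanishing outside of it, with the Lipschitz-type condition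
`|K (x + y) - K x| ≤ Ψ x * |y|` inside its compact support `tsupport K` for small `y`.
As `K` has a jump at `± c₁`, the condition is required only for `x + y` in the support. -/
structure KernelAssumption (K : ℝ → ℝ) : Prop where
  measurable : Measurable K
  symm : ∀ x, K (-x) = K x
  nonneg : ∀ x, 0 ≤ K x
  integrable : Integrable K volume
  integral_eq_one : ∫ x, K x = 1
  bounds : ∃ c₁ c₂ c₃ : ℝ, 0 < c₁ ∧ 0 < c₂ ∧ c₂ < c₃ ∧
    ∀ x, c₂ * (Set.Icc (-c₁) c₁).indicator (fun _ => (1 : ℝ)) x ≤ K x ∧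
      K x ≤ c₃ * (Set.Icc (-c₁) c₁).indicator (fun _ => (1 : ℝ)) x
  lipschitz : ∃ Ψ : ℝ → ℝ,
    (∀ x ∈ tsupport K, 0 ≤ Ψ x) ∧
    (∃ B : ℝ, ∀ x ∈ tsupport K, Ψ x ≤ B) ∧
    ∀ x ∈ tsupport K, ∃ δ > 0, ∀ y : ℝ, |y| < δ → x + y ∈ tsupport K →
      |K (x + y) - K x| ≤ Ψ x * |y|

/-- Assumptions on the bandwidth `h = h T`. The upper limit is taken in the extended reals. -/
structure BandwidthAssumption (h : ℕ → ℝ) : Prop where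
  pos : ∀ T : ℕ, 1 ≤ T → 0 < h T
  upper : Tendsto (fun T : ℕ => (T : ℝ) ^ (3 / 10 : ℝ) * h T) atTop (𝓝 0)
  lower : ∀ ε : ℝ, 0 < ε → ε < 1 / 5 →
    limsup (fun T : ℕ => (((T : ℝ) ^ (1 / 2 - ε) * h T : ℝ) : EReal)) atTop = ⊤

/-- The autoregressive model `X t = g (X (t - 1)) + u t`, `t ≥ 1`, started at `X 0 = 0`. -/
structure IsModel {Ω : Type*} [MeasurableSpace Ω] (P : Measure Ω)
    (g : ℝ → ℝ) (u X : ℕ → Ω → ℝ) : Prop where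
  init : ∀ᵐ ω ∂P, X 0 ω = 0
  step : ∀ t : ℕ, 1 ≤ t → ∀ᵐ ω ∂P, X t ω = g (X (t - 1) ω) + u t ω

/-- The null hypothesis: `g (X (t - 1)) = X (t - 1)` with probability one, for all `t ≥ 1`. -/
def NullHypothesis {Ω : Type*} [MeasurableSpace Ω] (P : Measure Ω)
    (g : ℝ → ℝ) (X : ℕ → Ω → ℝ) : Prop :=
  ∀ t : ℕ, 1 ≤ t → ∀ᵐ ω ∂P, g (X (t - 1) ω) = X (t - 1) ω

/-- The unstudentised statistic
`∑_{t=1}^T ∑_{s=1, s≠t}^T u_s K ((X_{t-1} - X_{s-1}) / b) u_t` with bandwidth `b`. -/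
noncomputable def statistic {Ω : Type*} (K : ℝ → ℝ) (b : ℝ) (u X : ℕ → Ω → ℝ)
    (T : ℕ) (ω : Ω) : ℝ :=
  ∑ t ∈ Finset.Icc 1 T, ∑ s ∈ (Finset.Icc 1 T).filter (fun s => s ≠ t),
    u s ω * K ((X (t - 1) ω - X (s - 1) ω) / b) * u t ω

/-- `σ_T²`, the expectation of the square of the statistic. -/
noncomputable def sigmaSq {Ω : Type*} [MeasurableSpace Ω] (P : Measure Ω) (K : ℝ → ℝ)
    (h : ℕ → ℝ) (u X : ℕ → Ω → ℝ) (T : ℕ) : ℝ :=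
  ∫ ω, (statistic K (h T) u X T ω) ^ 2 ∂P

/-- `σ_u`, the standard deviation of the centred errors, `σ_u² = E[u_1²]`. -/
noncomputable def sigmaU {Ω : Type*} [MeasurableSpace Ω] (P : Measure Ω)
    (u : ℕ → Ω → ℝ) : ℝ :=
  Real.sqrt (∫ ω, (u 1 ω) ^ 2 ∂P)

/-- The constant `16 σ_u³ ∫ K² / (3 √(2π))`. -/
noncomputable def constC10 {Ω : Type*} [MeasurableSpace Ω] (P : Measure Ω) (K : ℝ → ℝ)
    (u : ℕ → Ω → ℝ) : ℝ :=
  16 * sigmaU P u ^ 3 * (∫ x, (K x) ^ 2) / (3 * Real.sqrt (2 * Real.pi))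

end KernelUnitRoot

/-!
Under the null hypothesis `X` is almost surely the random walk with steps `u`, so the statistic is a
function of the i.i.d. errors alone, and everything is computed on sequence space under the product
measure `iidLaw μ`. Index the errors by `x₀, x₁, …`. As `K` is even, the statistic is
`2 ∑_{i < T} x_i M_i` with `M_i = ∑_{j < i} x_j K ((x_j + ⋯ + x_{i-1}) / h)`.

The summands `x_i M_i` are martingale differences, so `σ_T² = 4 σ_u² ∑_{i < T} E[M_i²]`
(`integral_halfStatistic_sq`), and expanding `M_i²` leaves diagonal and cross terms.

*Cross terms.* For `j < l < i` put `A = x_j + ⋯ + x_{l-1}` and `B = x_l + ⋯ + x_{i-1}`. By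
exchangeability, `E[x_j x_l K((A+B)/h) K(B/h)] = E[A B K((A+B)/h) K(B/h)] / ((l-j)(i-l))`, and the
bounded support of `K` makes this `O(h² / ((l-j)(i-l)))` (`abs_integral_cross_le`). The sum of the
cross terms over `j < l < i < T` is therefore `O(T h² log² T)`, which is `o(T^{3/2} h)` as `h → 0`.

*Diagonal terms.* By stationarity they are `D_m = E[x₀² K²((x₀ + ⋯ + x_m) / h)]`, with `m = i-j-1`.
For `m ≥ 1`, integrating out `x_m` and applying Fourier inversion to its density gives
`D_m = (h / 2π) ∫ k(h v) q(v) ψ(v)^m dv`, where `k` is the Fourier transform of `K²` and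
`q(v) = E[x₀² e^{i v x₀}]` (`integral_sq_mul_comp_blockSum`). The integral is treated as in the
local limit theorem: `√m D_m / h → σ_u ∫ K² / √(2π)` as `m → ∞` and `h → 0` jointly
(`tendsto_diagonalTerm`). The domination needed away from the origin comes from the doubling
inequality `1 - ψ(2v)² ≤ 4 (1 - ψ(v)²)` and the Riemann-Lebesgue lemma (`exists_charFun_decay`).

Since `∑_{i < T} ∑_{1 ≤ m < i} m^{-1/2} ~ (4/3) T^{3/2}`, the diagonal terms produce the constant
`4 σ_u² · (4/3) · σ_u ∫ K² / √(2π)`.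
-/

namespace KernelUnitRoot

open scoped FourierTransform

/-! ### Fourier inversion and a Parseval formula -/

section CharacteristicFunction

variable {μ : Measure ℝ} {f : ℝ → ℝ}

lemma integral_eq_integral_density {E : Type*} [NormedAddCommGroup E] [NormedSpace ℝ E]
    (hf0 : ∀ x, 0 ≤ f x) (hfc : Continuous f)
    (hμ : μ = volume.withDensity (fun x => ENNReal.ofReal (f x))) (F : ℝ → E) :
    ∫ x, F x ∂μ = ∫ x, f x • F x := by
  rw [hμ, integral_withDensity_eq_integral_toReal_smul (by fun_prop) (by simp)]
  simp [ENNReal.toReal_ofReal (hf0 _)]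

lemma fourier_density (hf0 : ∀ x, 0 ≤ f x) (hfc : Continuous f)
    (hμ : μ = volume.withDensity (fun x => ENNReal.ofReal (f x))) (s : ℝ) :
    𝓕 (fun x => (f x : ℂ)) s = charFun μ (-(2 * Real.pi * s)) := by
  rw [charFun_apply_real, integral_eq_integral_density hf0 hfc hμ,
    Real.fourier_real_eq_integral_exp_smul]
  refine integral_congr_ae (ae_of_all _ fun x => ?_)
  simp only [smul_eq_mul, Complex.real_smul]
  rw [mul_comm]
  congr 2
  push_cast
  ring

lemma tendsto_charFun_cocompact (hf0 : ∀ x, 0 ≤ f x) (hfc : Continuous f)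
    (hμ : μ = volume.withDensity (fun x => ENNReal.ofReal (f x))) :
    Tendsto (charFun μ) (cocompact ℝ) (𝓝 0) := by
  have h1 := Real.zero_at_infty_fourier (fun x => (f x : ℂ))
  have h2 : Tendsto (fun v : ℝ => -(2 * Real.pi)⁻¹ * v) (cocompact ℝ) (cocompact ℝ) :=
    (Homeomorph.mulLeft₀ (-(2 * Real.pi)⁻¹)
      (by simp [Real.pi_ne_zero])).isClosedEmbedding.tendsto_cocompact
  refine (h1.comp h2).congr fun v => ?_
  rw [Function.comp_apply, fourier_density hf0 hfc hμ]
  congr 1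
  field_simp

variable [IsProbabilityMeasure μ]

/-- Integrability of `v ψ(v)` controls `ψ` at infinity; near the origin `|ψ| ≤ 1`. -/
lemma integrable_charFun (h : Integrable (fun v : ℝ => |v| * ‖charFun μ v‖) volume) :
    Integrable (charFun μ) volume := by
  have h1 : Integrable ((Set.Icc (-1 : ℝ) 1).indicator fun _ => (1 : ℝ)) volume :=
    (integrable_indicator_iff measurableSet_Icc).2 (integrableOn_const (by simp))
  refine (h1.add h).mono' stronglyMeasurable_charFun.aestronglyMeasurable (ae_of_all _ fun v => ?_)
  have hn := norm_nonneg (charFun μ v)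
  by_cases hv : v ∈ Set.Icc (-1 : ℝ) 1
  · simp only [Pi.add_apply, Set.indicator_of_mem hv]
    have := norm_charFun_le_one (μ := μ) v
    have : 0 ≤ |v| * ‖charFun μ v‖ := by positivity
    linarith
  · simp only [Pi.add_apply, Set.indicator_of_notMem hv, zero_add]
    have : 1 ≤ |v| := by
      by_contra hlt
      exact hv (abs_le.1 (not_le.1 hlt).le)
    nlinarith

lemma integrable_of_eq_withDensity (hf0 : ∀ x, 0 ≤ f x) (hfc : Continuous f)
    (hμ : μ = volume.withDensity (fun x => ENNReal.ofReal (f x))) : Integrable f volume := by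
  refine ⟨hfc.aestronglyMeasurable, ?_⟩
  have h1 : μ Set.univ = 1 := measure_univ
  rw [hμ, withDensity_apply _ MeasurableSet.univ, Measure.restrict_univ] at h1
  rw [hasFiniteIntegral_iff_ofReal (ae_of_all _ hf0), h1]
  exact ENNReal.one_lt_top

/-- Fourier inversion, in the normalisation of characteristic functions. -/
lemma density_eq_integral_charFun (hf0 : ∀ x, 0 ≤ f x) (hfc : Continuous f)
    (hμ : μ = volume.withDensity (fun x => ENNReal.ofReal (f x)))
    (hψ : Integrable (charFun μ) volume) (y : ℝ) :
    (f y : ℂ) = (2 * Real.pi : ℝ)⁻¹ •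
      ∫ v : ℝ, Complex.exp (-(v * y * Complex.I)) * charFun μ v := by
  have hfi : Integrable (fun x => (f x : ℂ)) volume :=
    (integrable_of_eq_withDensity hf0 hfc hμ).ofReal
  have hF : 𝓕 (fun x => (f x : ℂ)) = fun s => charFun μ (-(2 * Real.pi) * s) := by
    ext s; rw [fourier_density hf0 hfc hμ]; congr 1; ring
  have hpi : -(2 * Real.pi) ≠ 0 := by simp [Real.pi_ne_zero]
  have h1 := hfi.fourierInv_fourier_eq (v := y) (by
    have := hF ▸ hψ.comp_mul_left' hpi
    exact this) (by fun_prop)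
  rw [← h1, Real.fourierInv_eq']
  have h2 := Measure.integral_comp_mul_left
    (fun v : ℝ => Complex.exp (-(v * y * Complex.I)) * charFun μ v) (-(2 * Real.pi))
  rw [abs_inv, abs_neg, abs_of_pos (by positivity)] at h2
  rw [← h2]
  refine integral_congr_ae (ae_of_all _ fun s => ?_)
  rw [hF]
  simp only [smul_eq_mul, RCLike.inner_apply, conj_trivial]
  congr 2
  push_cast
  ring

/-- The Fourier transform `t ↦ ∫ Q z e^{-itz} dz` of a real function, normalised as the
characteristic function is. -/
noncomputable def transform (Q : ℝ → ℝ) (t : ℝ) : ℂ :=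
  ∫ z : ℝ, (Q z : ℂ) * Complex.exp (-(t * z * Complex.I))

lemma norm_exp_neg_mul_I (a b : ℝ) : ‖Complex.exp (-(a * b * Complex.I))‖ = 1 := by
  have : -((a : ℂ) * b * Complex.I) = ((-(a * b) : ℝ) : ℂ) * Complex.I := by push_cast; ring
  rw [this, Complex.norm_exp_ofReal_mul_I]

lemma norm_exp_mul_I (a b : ℝ) : ‖Complex.exp (a * b * Complex.I)‖ = 1 := by
  rw [← Complex.ofReal_mul, Complex.norm_exp_ofReal_mul_I]

variable {Q : ℝ → ℝ}

lemma integrable_mul_exp (hQ : Integrable Q volume) (t : ℝ) :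
    Integrable (fun z : ℝ => (Q z : ℂ) * Complex.exp (-(t * z * Complex.I))) volume := by
  refine hQ.ofReal.mul_bdd (c := 1) (by fun_prop) (ae_of_all _ fun z => ?_)
  exact (norm_exp_neg_mul_I t z).le

lemma norm_transform_le (t : ℝ) : ‖transform Q t‖ ≤ ∫ z, |Q z| := by
  refine (norm_integral_le_integral_norm _).trans_eq ?_
  simp [norm_exp_neg_mul_I]

lemma transform_zero : transform Q 0 = ((∫ z, Q z : ℝ) : ℂ) := by
  simp [transform, integral_complex_ofReal]

lemma continuous_transform (hQ : Integrable Q volume) : Continuous (transform Q) := by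
  refine continuous_of_dominated (bound := fun z => |Q z|) (fun t => ?_) (fun t => ?_) hQ.abs ?_
  · exact (integrable_mul_exp hQ t).aestronglyMeasurable
  · exact ae_of_all _ fun z => by simp [norm_exp_neg_mul_I]
  · exact ae_of_all _ fun z => by fun_prop

/-- A Parseval formula: the mean of `Q ((w + x) / b)` under a law with integrable characteristic
function, by Fourier inversion of the density. -/
lemma integral_comp_add_div (hf0 : ∀ x, 0 ≤ f x) (hfc : Continuous f)
    (hμ : μ = volume.withDensity (fun x => ENNReal.ofReal (f x)))
    (hψ : Integrable (charFun μ) volume) (hQ : Integrable Q volume) {b : ℝ} (hb : 0 < b) (w : ℝ) :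
    ((∫ x, Q ((w + x) / b) ∂μ : ℝ) : ℂ) = (b / (2 * Real.pi) : ℝ) •
      ∫ v : ℝ, Complex.exp (v * w * Complex.I) * (charFun μ v * transform Q (b * v)) := by
  have h1 : ∫ x, Q ((w + x) / b) ∂μ = b * ∫ z, f (b * z - w) * Q z := by
    rw [integral_eq_integral_density hf0 hfc hμ]
    have e1 := integral_add_left_eq_self (μ := volume) (fun x => f (x - w) * Q (x / b)) w
    have e2 := Measure.integral_comp_mul_left (fun x => f (x - w) * Q (x / b)) b
    rw [abs_of_pos (by positivity), e1.symm, smul_eq_mul] at e2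
    have e3 : ∀ z, f (b * z - w) * Q (b * z / b) = f (b * z - w) * Q z := fun z => by
      rw [mul_div_cancel_left₀ _ hb.ne']
    simp only [e3, add_sub_cancel_left] at e2
    rw [e2]
    simp only [smul_eq_mul]
    field_simp
  have hsw : Integrable (Function.uncurry fun (z v : ℝ) =>
      (Complex.exp (-(v * (b * z - w : ℝ) * Complex.I)) * charFun μ v) * (Q z : ℂ))
      (volume.prod volume) := by
    have hp : Integrable (fun p : ℝ × ℝ => (Q p.1 : ℂ) * charFun μ p.2) (volume.prod volume) :=
      hQ.ofReal.mul_prod hψ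
    have := hp.bdd_mul (c := 1) (f := fun p : ℝ × ℝ =>
      Complex.exp (-(p.2 * (b * p.1 - w : ℝ) * Complex.I))) (by fun_prop)
      (ae_of_all _ fun p => (norm_exp_neg_mul_I p.2 (b * p.1 - w)).le)
    refine this.congr (ae_of_all _ fun p => ?_)
    simp only [Function.uncurry]
    ring
  have h2 : ((∫ z, f (b * z - w) * Q z : ℝ) : ℂ) = (2 * Real.pi : ℝ)⁻¹ •
      ∫ v : ℝ, Complex.exp (v * w * Complex.I) * (charFun μ v * transform Q (b * v)) := by
    rw [← integral_complex_ofReal]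
    calc ∫ z, ((f (b * z - w) * Q z : ℝ) : ℂ)
        = ∫ z, (2 * Real.pi : ℝ)⁻¹ • ∫ v : ℝ,
            (Complex.exp (-(v * (b * z - w : ℝ) * Complex.I)) * charFun μ v) * (Q z : ℂ) := by
          refine integral_congr_ae (ae_of_all _ fun z => ?_)
          simp only [Complex.ofReal_mul]
          rw [density_eq_integral_charFun hf0 hfc hμ hψ, integral_mul_const, smul_mul_assoc]
      _ = (2 * Real.pi : ℝ)⁻¹ • ∫ v : ℝ, ∫ z : ℝ,
            (Complex.exp (-(v * (b * z - w : ℝ) * Complex.I)) * charFun μ v) * (Q z : ℂ) := by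
          rw [integral_smul, integral_integral_swap hsw]
      _ = _ := by
          congr 1
          refine integral_congr_ae (ae_of_all _ fun v => ?_)
          simp only [transform]
          rw [← integral_const_mul, ← integral_const_mul]
          refine integral_congr_ae (ae_of_all _ fun z => ?_)
          have : Complex.exp (-(v * (b * z - w : ℝ) * Complex.I)) =
              Complex.exp (v * w * Complex.I) * Complex.exp (-((b * v : ℝ) * z * Complex.I)) := by
            rw [← Complex.exp_add]
            congr 1
            push_cast
            ring
          simp only [this]
          ring
  rw [h1, Complex.ofReal_mul, h2, div_eq_mul_inv, mul_smul]
  simp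

end CharacteristicFunction

/-! ### Decay of the characteristic function -/

section Decay

variable {μ : Measure ℝ} [IsProbabilityMeasure μ] {f : ℝ → ℝ}

lemma integrable_cos_mul (v : ℝ) : Integrable (fun x => Real.cos (v * x)) μ :=
  Integrable.of_bound (C := 1) (by fun_prop) (ae_of_all _ fun x => by
    simpa using Real.abs_cos_le_one _)

/-- The characteristic function of a symmetric law is real. -/
lemma charFun_eq_integral_cos (hf0 : ∀ x, 0 ≤ f x) (hfc : Continuous f) (hfs : ∀ x, f (-x) = f x)
    (hμ : μ = volume.withDensity (fun x => ENNReal.ofReal (f x))) (v : ℝ) :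
    charFun μ v = ((∫ x, Real.cos (v * x) ∂μ : ℝ) : ℂ) := by
  have h1 : charFun μ v = charFun μ (-v) := by
    rw [charFun_apply_real, charFun_apply_real, integral_eq_integral_density hf0 hfc hμ,
      integral_eq_integral_density hf0 hfc hμ, ← integral_neg_eq_self]
    refine integral_congr_ae (ae_of_all _ fun x => ?_)
    simp only [hfs]
    congr 2
    push_cast
    ring
  have h2 : 2 * charFun μ v = charFun μ v + charFun μ (-v) := by rw [← h1]; ring
  have hi : ∀ t : ℝ, Integrable (fun x : ℝ => Complex.exp (t * x * Complex.I)) μ := fun t =>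
    Integrable.of_bound (C := 1) (by fun_prop) (ae_of_all _ fun x => (norm_exp_mul_I t x).le)
  rw [charFun_apply_real, charFun_apply_real, ← integral_add (hi v) (hi (-v))] at h2
  rw [charFun_apply_real, ← integral_complex_ofReal]
  apply mul_left_cancel₀ (two_ne_zero' ℂ)
  rw [h2, ← integral_const_mul]
  refine integral_congr_ae (ae_of_all _ fun x => ?_)
  simp only [Complex.ofReal_cos, Complex.cos]
  rw [mul_div_cancel₀ _ (two_ne_zero' ℂ)]
  congr 2 <;> push_cast <;> ring

/-- Doubling the argument at most quadruples `1 - ψ²` when `ψ` is real; this is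
`cos 2θ = 2 cos² θ - 1` and the Cauchy-Schwarz inequality. -/
lemma one_sub_sq_charFun_two_mul_le (hf0 : ∀ x, 0 ≤ f x) (hfc : Continuous f)
    (hfs : ∀ x, f (-x) = f x)
    (hμ : μ = volume.withDensity (fun x => ENNReal.ofReal (f x))) (v : ℝ) :
    1 - ‖charFun μ (2 * v)‖ ^ 2 ≤ 4 * (1 - ‖charFun μ v‖ ^ 2) := by
  have hle := norm_charFun_le_one (μ := μ) (2 * v)
  rw [charFun_eq_integral_cos hf0 hfc hfs hμ, Complex.norm_real, Real.norm_eq_abs] at hle ⊢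
  rw [charFun_eq_integral_cos hf0 hfc hfs hμ, Complex.norm_real, Real.norm_eq_abs, sq_abs, sq_abs]
  set c := ∫ x, Real.cos (v * x) ∂μ with hc
  set d := ∫ x, Real.cos (2 * v * x) ∂μ with hd
  have hint : Integrable (fun x => Real.cos (v * x) ^ 2) μ :=
    Integrable.of_bound (C := 1) (by fun_prop) (ae_of_all _ fun x => by
      simpa using Real.abs_cos_le_one _)
  have h1 : 2 * c ^ 2 - 1 ≤ d := by
    have hcs : c ^ 2 ≤ ∫ x, Real.cos (v * x) ^ 2 ∂μ := by
      have h0 : 0 ≤ ∫ x, (Real.cos (v * x) - c) ^ 2 ∂μ := integral_nonneg fun x => sq_nonneg _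
      have e : ∫ x, (Real.cos (v * x) - c) ^ 2 ∂μ
          = ∫ x, Real.cos (v * x) ^ 2 ∂μ - 2 * c * c + c ^ 2 := by
        have : ∀ x, (Real.cos (v * x) - c) ^ 2
            = Real.cos (v * x) ^ 2 - 2 * c * Real.cos (v * x) + c ^ 2 := fun x => by ring
        simp only [this]
        have hcos : Integrable (fun x => 2 * c * Real.cos (v * x)) μ :=
          (integrable_cos_mul v).const_mul _
        have hsub : Integrable (fun x => Real.cos (v * x) ^ 2 - 2 * c * Real.cos (v * x)) μ :=
          hint.sub hcos
        rw [integral_add hsub (integrable_const _), integral_sub hint hcos, integral_const_mul]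
        simp [hc]
      nlinarith
    have e : d = 2 * ∫ x, Real.cos (v * x) ^ 2 ∂μ - 1 := by
      have : ∀ x, Real.cos (2 * v * x) = 2 * Real.cos (v * x) ^ 2 - 1 := fun x => by
        rw [← Real.cos_two_mul]; ring_nf
      rw [hd]
      simp only [this]
      rw [integral_sub (hint.const_mul _) (integrable_const _), integral_const_mul]
      simp
    linarith
  rcases abs_le.1 hle with ⟨h2, h3⟩
  nlinarith

/-- A symmetric law with a continuous density has a characteristic function with Gaussian decay near
the origin, bounded away from `1` elsewhere. -/
lemma exists_charFun_decay (hf0 : ∀ x, 0 ≤ f x) (hfc : Continuous f) (hfs : ∀ x, f (-x) = f x)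
    (hμ : μ = volume.withDensity (fun x => ENNReal.ofReal (f x))) :
    ∃ M c : ℝ, 0 < M ∧ 0 < c ∧ (∀ v, |v| ≤ M → ‖charFun μ v‖ ≤ Real.exp (-c * v ^ 2)) ∧
      ∀ v, M ≤ |v| → ‖charFun μ v‖ ≤ 1 / 2 := by
  have h1 := (tendsto_charFun_cocompact hf0 hfc hμ).norm
  rw [norm_zero] at h1
  have h2 := h1.eventually (gt_mem_nhds (show (0 : ℝ) < 1 / 2 by norm_num))
  rw [← Metric.cobounded_eq_cocompact,
    Metric.hasBasis_cobounded_compl_closedBall 0 |>.eventually_iff] at h2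
  obtain ⟨r, -, hr⟩ := h2
  set M := max r 0 + 1 with hM
  have hM0 : 0 < M := by positivity
  have hfar : ∀ v, M ≤ |v| → ‖charFun μ v‖ ≤ 1 / 2 := fun v hv => by
    refine (hr ?_).le
    simp only [Set.mem_compl_iff, Metric.mem_closedBall, dist_zero_right, Real.norm_eq_abs, not_le]
    have := le_max_left r 0
    linarith
  refine ⟨M, 3 / (32 * M ^ 2), hM0, by positivity, fun v hv => ?_, hfar⟩
  have hdouble : ∀ n : ℕ, ∀ v,
      1 - ‖charFun μ (2 ^ n * v)‖ ^ 2 ≤ 4 ^ n * (1 - ‖charFun μ v‖ ^ 2) := by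
    intro n
    induction n with
    | zero => intro v; simp
    | succ n ih =>
      intro v
      have := one_sub_sq_charFun_two_mul_le hf0 hfc hfs hμ (2 ^ n * v)
      have h3 := ih v
      rw [show (2 : ℝ) ^ (n + 1) * v = 2 * (2 ^ n * v) by ring]
      rw [show (4 : ℝ) ^ (n + 1) * (1 - ‖charFun μ v‖ ^ 2)
        = 4 * (4 ^ n * (1 - ‖charFun μ v‖ ^ 2)) by ring]
      linarith
  have key : 3 * v ^ 2 / (16 * M ^ 2) ≤ 1 - ‖charFun μ v‖ ^ 2 := by
    rcases eq_or_ne v 0 with rfl | hv0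
    · simp
    have hv0' : 0 < |v| := abs_pos.2 hv0
    -- `2 ^ n` is the first power of two that carries `|v|` beyond `M`, so `2 ^ n * |v| ≤ 2 * M`.
    have hex : ∃ n : ℕ, M ≤ 2 ^ n * |v| := by
      obtain ⟨n, hn⟩ := pow_unbounded_of_one_lt (M / |v|) (one_lt_two)
      exact ⟨n, ((div_lt_iff₀ hv0').1 hn).le⟩
    classical
    obtain ⟨n, hn1, hn2⟩ : ∃ n : ℕ, M ≤ 2 ^ n * |v| ∧ 2 ^ n * |v| ≤ 2 * M := by
      refine ⟨Nat.find hex, Nat.find_spec hex, ?_⟩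
      rcases Nat.eq_zero_or_pos (Nat.find hex) with h0 | h0
      · rw [h0]; simp; linarith
      · have := Nat.find_min hex (Nat.sub_lt h0 one_pos)
        obtain ⟨k, hk⟩ := Nat.exists_eq_succ_of_ne_zero h0.ne'
        rw [hk] at this ⊢
        simp only [Nat.succ_eq_add_one, add_tsub_cancel_right, not_le] at this
        rw [Nat.succ_eq_add_one, pow_succ]
        linarith
    have h4 := hfar (2 ^ n * v) (by rwa [abs_mul, abs_of_pos (by positivity)])
    have h5 := hdouble n v
    have h6 : ‖charFun μ (2 ^ n * v)‖ ^ 2 ≤ 1 / 4 := by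
      nlinarith [norm_nonneg (charFun μ (2 ^ n * v))]
    have h7 : (4 : ℝ) ^ n * v ^ 2 ≤ 4 * M ^ 2 := by
      have : (4 : ℝ) ^ n * v ^ 2 = (2 ^ n * |v|) ^ 2 := by
        rw [mul_pow, sq_abs, ← pow_mul, mul_comm n 2, pow_mul]; norm_num
      rw [this]
      have : 0 ≤ 2 ^ n * |v| := by positivity
      nlinarith
    rw [div_le_iff₀ (by positivity)]
    have h8 : 3 / 4 ≤ 4 ^ n * (1 - ‖charFun μ v‖ ^ 2) := by linarith
    have h9 : 0 ≤ 1 - ‖charFun μ v‖ ^ 2 := by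
      have : (0 : ℝ) < 4 ^ n := by positivity
      by_contra hneg
      have := mul_neg_of_pos_of_neg this (not_le.1 hneg)
      linarith
    have h10 := mul_le_mul_of_nonneg_left h7 h9
    nlinarith [mul_le_mul_of_nonneg_right h8 (sq_nonneg v)]
  have h11 : ‖charFun μ v‖ ^ 2 ≤ Real.exp (-(3 / (32 * M ^ 2)) * v ^ 2) ^ 2 := by
    have := Real.add_one_le_exp (-(3 * v ^ 2 / (16 * M ^ 2)))
    rw [← Real.exp_nat_mul]
    have e : ((2 : ℕ) : ℝ) * (-(3 / (32 * M ^ 2)) * v ^ 2) = -(3 * v ^ 2 / (16 * M ^ 2)) := by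
      push_cast; field_simp; ring
    rw [e]
    linarith
  exact le_of_sq_le_sq h11 (Real.exp_pos _).le

end Decay

/-! ### The local limit theorem in Fourier form -/

section LocalLimit

variable {μ : Measure ℝ} {f : ℝ → ℝ} {Q : ℝ → ℝ}

/-- The Fourier transform `v ↦ ∫ x² e^{ivx} dμ` of the second-moment measure of `μ`. -/
noncomputable def sqCharFun (μ : Measure ℝ) (v : ℝ) : ℂ :=
  ∫ x : ℝ, ((x ^ 2 : ℝ) : ℂ) * Complex.exp (v * x * Complex.I) ∂μ

lemma integrable_sq_mul_exp (h2 : Integrable (fun x : ℝ => x ^ 2) μ) (v : ℝ) :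
    Integrable (fun x : ℝ => ((x ^ 2 : ℝ) : ℂ) * Complex.exp (v * x * Complex.I)) μ :=
  h2.ofReal.mul_bdd (c := 1) (by fun_prop) (ae_of_all _ fun z => (norm_exp_mul_I v z).le)

lemma norm_sqCharFun_le (v : ℝ) : ‖sqCharFun μ v‖ ≤ ∫ x, x ^ 2 ∂μ := by
  refine (norm_integral_le_integral_norm _).trans_eq ?_
  refine integral_congr_ae (ae_of_all _ fun x => ?_)
  simp [norm_exp_mul_I]

lemma sqCharFun_zero : sqCharFun μ 0 = ((∫ x, x ^ 2 ∂μ : ℝ) : ℂ) := by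
  rw [← integral_complex_ofReal]
  simp [sqCharFun]

lemma continuous_sqCharFun (h2 : Integrable (fun x : ℝ => x ^ 2) μ) :
    Continuous (sqCharFun μ) := by
  refine continuous_of_dominated (bound := fun x => x ^ 2) (fun t => ?_) (fun t => ?_) h2 ?_
  · exact (integrable_sq_mul_exp h2 t).aestronglyMeasurable
  · exact ae_of_all _ fun z => by simp [norm_exp_mul_I]
  · exact ae_of_all _ fun z => by fun_prop

lemma norm_transform_mul_sqCharFun_mul_pow_le (b v : ℝ) (n : ℕ) :
    ‖transform Q (b * v) * sqCharFun μ v * charFun μ v ^ n‖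
      ≤ (∫ z, |Q z|) * (∫ x, x ^ 2 ∂μ) * ‖charFun μ v‖ ^ n := by
  rw [norm_mul, norm_mul, norm_pow]
  gcongr
  · exact norm_transform_le _
  · exact norm_sqCharFun_le _

variable [IsProbabilityMeasure μ]

lemma tendsto_charFun_div_sqrt_pow (hm : ∫ x, x ∂μ = 0) {σ : ℝ} (hσ : 0 < σ)
    (h2 : ∫ x, x ^ 2 ∂μ = σ ^ 2) (w : ℝ) :
    Tendsto (fun n : ℕ => charFun μ (w / √n) ^ n) atTop
      (𝓝 ((Real.exp (-(σ ^ 2 / 2) * w ^ 2) : ℝ) : ℂ)) := by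
  have h := tendsto_charFun_inv_sqrt_mul_pow (P := μ) (X := fun x => σ⁻¹ * x) (by fun_prop)
    (by rw [integral_const_mul, hm, mul_zero]) (by
      have : ((fun x => σ⁻¹ * x) ^ 2 : ℝ → ℝ) = fun x => (σ ^ 2)⁻¹ * x ^ 2 := by
        ext x; simp [mul_pow]
      rw [this, integral_const_mul, h2, inv_mul_cancel₀ (by positivity)]) (σ * w)
  convert! h using 2 with n
  · rw [charFun_map_mul]
    congr 2
    field_simp
  · push_cast
    congr 1
    ring

lemma integrable_charFun_pow (hψ : Integrable (charFun μ) volume) {n : ℕ} (hn : 1 ≤ n) :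
    Integrable (fun v => ‖charFun μ v‖ ^ n) volume := by
  refine hψ.norm.mono' (by fun_prop) (ae_of_all _ fun v => ?_)
  rw [Real.norm_of_nonneg (by positivity)]
  exact pow_le_of_le_one (norm_nonneg _) (norm_charFun_le_one v) (by omega)

lemma integrable_transform_mul_sqCharFun_mul_pow (hψ : Integrable (charFun μ) volume)
    (hQ : Integrable Q volume) (h2 : Integrable (fun x : ℝ => x ^ 2) μ) (b : ℝ) {n : ℕ}
    (hn : 1 ≤ n) :
    Integrable (fun v => transform Q (b * v) * sqCharFun μ v * charFun μ v ^ n) volume := by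
  refine ((integrable_charFun_pow hψ hn).const_mul
    ((∫ z, |Q z|) * ∫ x, x ^ 2 ∂μ)).mono' ?_ (ae_of_all _ fun v =>
      norm_transform_mul_sqCharFun_mul_pow_le b v n)
  have hT := continuous_transform hQ
  have hS := continuous_sqCharFun h2
  exact ((by fun_prop : Continuous fun v => transform Q (b * v) * sqCharFun μ v).measurable.mul
    (measurable_charFun.pow_const n)).aestronglyMeasurable

/-- The local limit theorem in Fourier form. The integrand is concentrated on `|v| ≲ n^{-1/2}`:
on a fixed neighbourhood of the origin the Gaussian decay of the characteristic function allows
dominated convergence after the substitution `v = w / √n`, and the rest is exponentially small. -/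
lemma tendsto_sqrt_mul_integral (hf0 : ∀ x, 0 ≤ f x) (hfc : Continuous f)
    (hfs : ∀ x, f (-x) = f x)
    (hμ : μ = volume.withDensity (fun x => ENNReal.ofReal (f x)))
    (hψ : Integrable (charFun μ) volume) (hQ : Integrable Q volume)
    (hm : ∫ x, x ∂μ = 0) {σ : ℝ} (hσ : 0 < σ)
    (h2i : Integrable (fun x : ℝ => x ^ 2) μ) (h2 : ∫ x, x ^ 2 ∂μ = σ ^ 2) :
    Tendsto (fun p : ℕ × ℝ => (√(p.1 : ℝ) : ℂ) *
        ∫ v, transform Q (p.2 * v) * sqCharFun μ v * charFun μ v ^ p.1) (atTop ×ˢ 𝓝[>] 0)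
      (𝓝 (((∫ z, Q z) * σ * √(2 * Real.pi) : ℝ) : ℂ)) := by
  obtain ⟨M, c, hM, hc, hnear, hfar⟩ := exists_charFun_decay hf0 hfc hfs hμ
  have hT := continuous_transform hQ
  have hS := continuous_sqCharFun h2i
  set G : ℕ × ℝ → ℝ → ℂ := fun p v => transform Q (p.2 * v) * sqCharFun μ v * charFun μ v ^ p.1
    with hG
  set A := (∫ z, |Q z|) * ∫ x, x ^ 2 ∂μ with hA
  have hA0 : 0 ≤ A := mul_nonneg (integral_nonneg fun z => abs_nonneg _)
    (integral_nonneg fun z => sq_nonneg _)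
  have hGm : ∀ p, Measurable (G p) := fun p =>
    (by fun_prop : Continuous fun v => transform Q (p.2 * v) * sqCharFun μ v).measurable.mul
      (measurable_charFun.pow_const p.1)
  have hGle : ∀ p v, ‖G p v‖ ≤ A * ‖charFun μ v‖ ^ p.1 := fun p v =>
    norm_transform_mul_sqCharFun_mul_pow_le _ _ _
  have hn1 : ∀ᶠ p : ℕ × ℝ in atTop ×ˢ 𝓝[>] 0, 1 ≤ p.1 :=
    (eventually_ge_atTop 1).prod_inl _
  have hfst : Tendsto (fun p : ℕ × ℝ => p.1) (atTop ×ˢ 𝓝[>] (0 : ℝ)) atTop := tendsto_fst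
  have hsnd : Tendsto (fun p : ℕ × ℝ => p.2) (atTop ×ˢ 𝓝[>] (0 : ℝ)) (𝓝 0) :=
    tendsto_snd.mono_right nhdsWithin_le_nhds
  set S : Set ℝ := Set.Icc (-M) M with hSdef
  have hSm : MeasurableSet S := measurableSet_Icc
  have near : Tendsto (fun p : ℕ × ℝ => ∫ w, S.indicator (G p) (w / √(p.1 : ℝ)))
      (atTop ×ˢ 𝓝[>] 0) (𝓝 (∫ w : ℝ, ((∫ z, Q z : ℝ) : ℂ) * ((σ ^ 2 : ℝ) : ℂ) *
        ((Real.exp (-(σ ^ 2 / 2) * w ^ 2) : ℝ) : ℂ))) := by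
    refine tendsto_integral_filter_of_dominated_convergence
      (fun w => A * Real.exp (-c * w ^ 2)) ?_ ?_ ?_ ?_
    · exact Eventually.of_forall fun p =>
        (((hGm p).indicator hSm).comp (measurable_id.div_const _)).aestronglyMeasurable
    · filter_upwards [hn1] with p hp
      refine ae_of_all _ fun w => ?_
      have hp0 : (0 : ℝ) < p.1 := by exact_mod_cast hp
      by_cases hw : w / √(p.1 : ℝ) ∈ S
      · rw [Set.indicator_of_mem hw]
        refine (hGle _ _).trans ?_
        gcongr
        have h3 := hnear _ (abs_le.2 hw)
        refine (pow_le_pow_left₀ (norm_nonneg _) h3 _).trans_eq ?_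
        rw [← Real.exp_nat_mul]
        congr 1
        rw [div_pow, Real.sq_sqrt hp0.le]
        field_simp
      · rw [Set.indicator_of_notMem hw, norm_zero]
        positivity
    · exact (integrable_exp_neg_mul_sq hc).const_mul A
    · refine ae_of_all _ fun w => ?_
      have hdiv : Tendsto (fun p : ℕ × ℝ => w / √(p.1 : ℝ)) (atTop ×ˢ 𝓝[>] 0) (𝓝 0) :=
        (tendsto_const_nhds.div_atTop
          (Real.tendsto_sqrt_atTop.comp tendsto_natCast_atTop_atTop)).comp hfst
      have hin : ∀ᶠ p : ℕ × ℝ in atTop ×ˢ 𝓝[>] 0, w / √(p.1 : ℝ) ∈ S :=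
        hdiv.eventually (Icc_mem_nhds (by linarith) hM)
      have l1 : Tendsto (fun p : ℕ × ℝ => transform Q (p.2 * (w / √(p.1 : ℝ))))
          (atTop ×ˢ 𝓝[>] 0) (𝓝 ((∫ z, Q z : ℝ) : ℂ)) := by
        rw [← transform_zero]
        refine (hT.tendsto 0).comp ?_
        simpa using hsnd.mul hdiv
      have l2 : Tendsto (fun p : ℕ × ℝ => sqCharFun μ (w / √(p.1 : ℝ)))
          (atTop ×ˢ 𝓝[>] 0) (𝓝 ((σ ^ 2 : ℝ) : ℂ)) := by
        rw [← h2, ← sqCharFun_zero]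
        exact (hS.tendsto 0).comp hdiv
      have l3 := (tendsto_charFun_div_sqrt_pow hm hσ h2 w).comp hfst
      refine ((l1.mul l2).mul l3).congr' ?_
      filter_upwards [hin] with p hp
      rw [Set.indicator_of_mem hp]
      rfl
  have far : Tendsto (fun p : ℕ × ℝ => (√(p.1 : ℝ) : ℂ) * ∫ v, Sᶜ.indicator (G p) v)
      (atTop ×ˢ 𝓝[>] 0) (𝓝 0) := by
    have hlim : Tendsto (fun n : ℕ => (n : ℝ) * (1 / 2) ^ n * (2 * (A * ∫ v, ‖charFun μ v‖)))
        atTop (𝓝 0) := by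
      have := (tendsto_self_mul_const_pow_of_lt_one (r := 1 / 2) (by norm_num)
        (by norm_num)).mul_const (2 * (A * ∫ v, ‖charFun μ v‖))
      rwa [zero_mul] at this
    refine squeeze_zero_norm' ?_ (hlim.comp hfst)
    filter_upwards [hn1] with p hp
    have hp1 : (1 : ℝ) ≤ p.1 := by exact_mod_cast hp
    have hbd : ‖∫ v, Sᶜ.indicator (G p) v‖ ≤ (1 / 2) ^ p.1 * (2 * (A * ∫ v, ‖charFun μ v‖)) := by
      rw [← integral_const_mul, ← integral_const_mul, ← integral_const_mul]
      refine norm_integral_le_of_norm_le (((hψ.norm.const_mul _).const_mul _).const_mul _)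
        (ae_of_all _ fun v => ?_)
      by_cases hv : v ∈ Sᶜ
      · rw [Set.indicator_of_mem hv]
        refine (hGle _ _).trans ?_
        have hv' : M ≤ |v| := by
          by_contra hlt
          exact hv (abs_le.1 (not_le.1 hlt).le)
        have h4 := hfar v hv'
        obtain ⟨k, hk⟩ : ∃ k, p.1 = k + 1 := ⟨p.1 - 1, by omega⟩
        rw [hk, pow_succ, pow_succ]
        have : ‖charFun μ v‖ ^ k ≤ (1 / 2) ^ k := pow_le_pow_left₀ (norm_nonneg _) h4 _
        calc A * (‖charFun μ v‖ ^ k * ‖charFun μ v‖)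
            ≤ A * ((1 / 2) ^ k * ‖charFun μ v‖) := by gcongr
          _ = _ := by ring
      · rw [Set.indicator_of_notMem hv, norm_zero]
        positivity
    rw [norm_mul, Complex.norm_real, Real.norm_of_nonneg (Real.sqrt_nonneg _), Function.comp_apply,
      mul_assoc]
    gcongr
    exact Real.sqrt_le_iff.2 ⟨by linarith, by nlinarith⟩
  have hval : ∫ w : ℝ, ((∫ z, Q z : ℝ) : ℂ) * ((σ ^ 2 : ℝ) : ℂ) *
        ((Real.exp (-(σ ^ 2 / 2) * w ^ 2) : ℝ) : ℂ)
      = (((∫ z, Q z) * σ * √(2 * Real.pi) : ℝ) : ℂ) := by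
    rw [integral_const_mul, integral_complex_ofReal, integral_gaussian]
    have : √(Real.pi / (σ ^ 2 / 2)) = √(2 * Real.pi) / σ := by
      rw [show Real.pi / (σ ^ 2 / 2) = (2 * Real.pi) / σ ^ 2 by field_simp,
        Real.sqrt_div (by positivity), Real.sqrt_sq hσ.le]
    rw [this, ← Complex.ofReal_mul, ← Complex.ofReal_mul]
    congr 1
    field_simp
  have hsum := near.add far
  rw [hval, add_zero] at hsum
  refine hsum.congr' ?_
  filter_upwards [hn1] with p hp
  have hp0 : (0 : ℝ) < √(p.1 : ℝ) := Real.sqrt_pos.2 (by exact_mod_cast hp)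
  have hGi : Integrable (G p) volume := integrable_transform_mul_sqCharFun_mul_pow hψ hQ h2i _ hp
  rw [Measure.integral_comp_div (S.indicator (G p)), abs_of_pos hp0, Complex.real_smul, ← mul_add,
    integral_indicator hSm, integral_indicator hSm.compl, integral_add_compl hSm hGi]

end LocalLimit

/-! ### I.i.d. sequences -/

/-- The sum `x j + ⋯ + x (i - 1)`: the increment of the random walk with steps `x` between the
times `j` and `i`. -/
def blockSum (j i : ℕ) (x : ℕ → ℝ) : ℝ := ∑ l ∈ Finset.Ico j i, x l

@[fun_prop]
lemma measurable_blockSum (j i : ℕ) : Measurable (blockSum j i) :=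
  Finset.measurable_fun_sum _ fun _ _ => measurable_pi_apply _

lemma dependsOn_blockSum {j i n : ℕ} (h : i ≤ n) : DependsOn (blockSum j i) (Set.Iio n) :=
  fun _ _ hxy => Finset.sum_congr rfl fun l hl =>
    hxy l (lt_of_lt_of_le (Finset.mem_Ico.1 hl).2 h)

lemma blockSum_comp_swap {j i a b : ℕ} (h : a ∈ Finset.Ico j i ↔ b ∈ Finset.Ico j i)
    (x : ℕ → ℝ) : blockSum j i (x ∘ Equiv.swap a b) = blockSum j i x := by
  refine Finset.sum_equiv (Equiv.swap a b) (fun l => ?_) (fun l _ => rfl)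
  rw [Equiv.swap_apply_def]
  split_ifs with h1 h2
  · rw [h1, h]
  · rw [h2, h]
  · rfl

section SequenceSpace

variable (μ : Measure ℝ) [IsProbabilityMeasure μ]

/-- The law on sequence space of an i.i.d. sequence with marginal law `μ`. -/
noncomputable abbrev iidLaw : Measure (ℕ → ℝ) := Measure.infinitePi fun _ : ℕ => μ

lemma iIndepFun_eval : iIndepFun (fun (i : ℕ) (x : ℕ → ℝ) => x i) (iidLaw μ) :=
  iIndepFun_infinitePi (P := fun _ : ℕ => μ) (X := fun _ y => y) fun _ => measurable_id

lemma map_eval (i : ℕ) : (iidLaw μ).map (fun x => x i) = μ :=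
  Measure.infinitePi_map_eval (fun _ : ℕ => μ) i

lemma measurePreserving_eval (i : ℕ) : MeasurePreserving (fun x : ℕ → ℝ => x i) (iidLaw μ) μ :=
  ⟨measurable_pi_apply i, map_eval μ i⟩

/-- Selecting distinct coordinates of an i.i.d. sequence does not change its law. -/
lemma measurePreserving_comp {e : ℕ → ℕ} (he : e.Injective) :
    MeasurePreserving (fun x : ℕ → ℝ => x ∘ e) (iidLaw μ) (iidLaw μ) := by
  refine ⟨by fun_prop, ?_⟩
  have h := ((iIndepFun_eval μ).precomp he).map_fun_eq_infinitePi_map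
    fun i => measurable_pi_apply (e i)
  simp only [map_eval] at h
  exact h

lemma integral_comp_injective {E : Type*} [NormedAddCommGroup E] [NormedSpace ℝ E]
    {e : ℕ → ℕ} (he : e.Injective) {F : (ℕ → ℝ) → E} (hF : AEStronglyMeasurable F (iidLaw μ)) :
    ∫ x, F (x ∘ e) ∂(iidLaw μ) = ∫ x, F x ∂(iidLaw μ) := by
  have h := measurePreserving_comp μ he
  rw [← integral_map h.aemeasurable (h.map_eq.symm ▸ hF), h.map_eq]

/-- A coordinate is independent of every function of the preceding ones. -/
lemma indepFun_eval_of_dependsOn {β : Type*} [MeasurableSpace β] {n : ℕ} {F : (ℕ → ℝ) → β}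
    (hF : Measurable F) (hd : DependsOn F (Set.Iio n)) :
    IndepFun (fun x : ℕ → ℝ => x n) F (iidLaw μ) := by
  have h := (iIndepFun_eval μ).indepFun_finset {n} (Finset.range n) (by simp)
    fun i => measurable_pi_apply i
  let g : (Finset.range n → ℝ) → β := fun y =>
    F fun l => if hl : l ∈ Finset.range n then y ⟨l, hl⟩ else 0
  have hg : Measurable g := by
    refine hF.comp (measurable_pi_lambda _ fun l => ?_)
    by_cases hl : l ∈ Finset.range n
    · simp only [hl, dite_true]; fun_prop
    · simp only [hl, dite_false]; fun_prop
  have hφ : Measurable fun y : ({n} : Finset ℕ) → ℝ => y ⟨n, by simp⟩ := measurable_pi_apply _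
  have h' := h.comp hφ hg
  have e : g ∘ (fun (x : ℕ → ℝ) (i : Finset.range n) => x i) = F := by
    ext x
    refine hd fun l hl => ?_
    rw [dif_pos (Finset.mem_range.2 hl)]
  rw [e] at h'
  exact h'

/-- The last coordinate may be integrated out separately. -/
lemma integral_comp_eval_of_dependsOn {β E : Type*} [MeasurableSpace β] [NormedAddCommGroup E]
    [NormedSpace ℝ E] {n : ℕ} {Y : (ℕ → ℝ) → β} (hY : Measurable Y)
    (hd : DependsOn Y (Set.Iio n)) {F : β × ℝ → E} (hF : StronglyMeasurable F)
    (hFi : Integrable (fun x => F (Y x, x n)) (iidLaw μ)) :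
    ∫ x, F (Y x, x n) ∂(iidLaw μ) = ∫ x, ∫ y, F (Y x, y) ∂μ ∂(iidLaw μ) := by
  have hind := (indepFun_eval_of_dependsOn μ hY hd).symm
  have hn : Measurable fun x : ℕ → ℝ => x n := measurable_pi_apply n
  have := Measure.isProbabilityMeasure_map (μ := iidLaw μ) hY.aemeasurable
  have hmap := (indepFun_iff_map_prod_eq_prod_map_map hY.aemeasurable hn.aemeasurable).1 hind
  rw [map_eval] at hmap
  have hFi' : Integrable F (((iidLaw μ).map Y).prod μ) := by
    rw [← hmap]
    exact (integrable_map_measure hF.aestronglyMeasurable (hY.prodMk hn).aemeasurable).2 hFi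
  rw [← integral_map (φ := fun x : ℕ → ℝ => (Y x, x n)) (hY.prodMk hn).aemeasurable
    hF.aestronglyMeasurable, hmap, integral_prod _ hFi',
    integral_map hY.aemeasurable]
  exact hF.integral_prod_right'.aestronglyMeasurable

/-- Exchangeability: against a function that is symmetric in the coordinates in `s`, each of these
coordinates integrates to the same value. -/
lemma card_mul_integral_eval_mul {s : Finset ℕ} {j : ℕ} {G : (ℕ → ℝ) → ℝ}
    (hG : Measurable G) (hsymm : ∀ l ∈ s, ∀ x, G (x ∘ Equiv.swap j l) = G x)
    (hint : ∀ l ∈ s, Integrable (fun x => x l * G x) (iidLaw μ)) :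
    (s.card : ℝ) * ∫ x, x j * G x ∂(iidLaw μ) = ∫ x, (∑ l ∈ s, x l) * G x ∂(iidLaw μ) := by
  simp only [Finset.sum_mul]
  rw [integral_finsetSum _ hint]
  have : ∀ l ∈ s, ∫ x, x l * G x ∂(iidLaw μ) = ∫ x, x j * G x ∂(iidLaw μ) := fun l hl => by
    have hm : Measurable fun x : ℕ → ℝ => x j * G x := (measurable_pi_apply j).mul hG
    rw [← integral_comp_injective μ (Equiv.swap j l).injective hm.aestronglyMeasurable]
    refine integral_congr_ae (ae_of_all _ fun x => ?_)
    simp [hsymm l hl x]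
  rw [Finset.sum_congr rfl this, Finset.sum_const, nsmul_eq_mul]

end SequenceSpace

/-! ### Second moment of the statistic: independence and exchangeability -/

/-- The part `∑_{j < i} x_j k (x_j + ⋯ + x_{i-1})` of the statistic that multiplies `x_i`. -/
def weightedSum (k : ℝ → ℝ) (i : ℕ) (x : ℕ → ℝ) : ℝ :=
  ∑ j ∈ Finset.range i, x j * k (blockSum j i x)

/-- Half of the statistic, as a function of the errors: the sum over the pairs `j < i < T`. -/
def halfStatistic (k : ℝ → ℝ) (T : ℕ) (x : ℕ → ℝ) : ℝ :=
  ∑ i ∈ Finset.range T, x i * weightedSum k i x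

variable {k : ℝ → ℝ}

lemma measurable_weightedSum (hk : Measurable k) (i : ℕ) : Measurable (weightedSum k i) :=
  Finset.measurable_fun_sum _ fun j _ =>
    (measurable_pi_apply j).mul (hk.comp (measurable_blockSum j i))

lemma dependsOn_weightedSum {i n : ℕ} (h : i ≤ n) : DependsOn (weightedSum k i) (Set.Iio n) :=
  fun x y hxy => Finset.sum_congr rfl fun j hj => by
    rw [dependsOn_blockSum h hxy, hxy j (lt_of_lt_of_le (Finset.mem_range.1 hj) h)]

lemma measurable_halfStatistic (hk : Measurable k) (T : ℕ) : Measurable (halfStatistic k T) :=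
  Finset.measurable_fun_sum _ fun i _ =>
    (measurable_pi_apply i).mul (measurable_weightedSum hk i)

lemma dependsOn_halfStatistic (T : ℕ) : DependsOn (halfStatistic k T) (Set.Iio T) :=
  fun x y hxy => Finset.sum_congr rfl fun i hi => by
    rw [dependsOn_weightedSum (Finset.mem_range.1 hi).le hxy, hxy i (Finset.mem_range.1 hi)]

lemma sq_sum_range (a : ℕ → ℝ) (n : ℕ) : (∑ l ∈ Finset.range n, a l) ^ 2
    = ∑ l ∈ Finset.range n, a l ^ 2
      + 2 * ∑ l ∈ Finset.range n, ∑ j ∈ Finset.range l, a j * a l := by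
  induction n with
  | zero => simp
  | succ n ih =>
    simp only [Finset.sum_range_succ, add_sq, ih, ← Finset.sum_mul]
    ring

section Moments

variable {μ : Measure ℝ} [IsProbabilityMeasure μ] {B : ℝ}

instance holderTriple_four_four_two : ENNReal.HolderTriple 4 4 2 where
  inv_add_inv_eq_inv := by
    have h : (4 : ENNReal)⁻¹ = 2⁻¹ * 2⁻¹ := by
      rw [← ENNReal.mul_inv (by simp) (by simp)]; norm_num
    rw [h, ← mul_add, ENNReal.inv_two_add_inv_two, mul_one]

lemma memLp_eval (h4 : MemLp id 4 μ) (i : ℕ) :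
    MemLp (fun x : ℕ → ℝ => x i) 4 (iidLaw μ) :=
  h4.comp_measurePreserving (measurePreserving_eval μ i)

lemma memLp_eval_mul_kernel (h4 : MemLp id 4 μ) (hk : Measurable k) (hB : ∀ y, |k y| ≤ B)
    (j i : ℕ) : MemLp (fun x => x j * k (blockSum j i x)) 4 (iidLaw μ) := by
  have hm : Measurable fun x => k (blockSum j i x) := hk.comp (measurable_blockSum j i)
  refine (memLp_eval h4 j).of_le_mul (c := B)
    ((measurable_pi_apply j).mul hm).aestronglyMeasurable (ae_of_all _ fun x => ?_)
  rw [norm_mul, mul_comm, Real.norm_eq_abs (k _)]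
  gcongr
  exact hB _

lemma memLp_weightedSum (h4 : MemLp id 4 μ) (hk : Measurable k) (hB : ∀ y, |k y| ≤ B) (i : ℕ) :
    MemLp (weightedSum k i) 4 (iidLaw μ) :=
  memLp_finsetSum _ fun j _ => memLp_eval_mul_kernel h4 hk hB j i

lemma memLp_eval_mul_weightedSum (h4 : MemLp id 4 μ) (hk : Measurable k) (hB : ∀ y, |k y| ≤ B)
    (l i : ℕ) : MemLp (fun x => x l * weightedSum k i x) 2 (iidLaw μ) :=
  (memLp_weightedSum h4 hk hB i).mul (memLp_eval h4 l)

lemma memLp_halfStatistic (h4 : MemLp id 4 μ) (hk : Measurable k) (hB : ∀ y, |k y| ≤ B) (T : ℕ) :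
    MemLp (halfStatistic k T) 2 (iidLaw μ) :=
  memLp_finsetSum _ fun i _ => memLp_eval_mul_weightedSum h4 hk hB i i

/-- The summands of the statistic are uncorrelated martingale differences. -/
lemma integral_halfStatistic_sq (h4 : MemLp id 4 μ) (hm : ∫ x, x ∂μ = 0) (hk : Measurable k)
    (hB : ∀ y, |k y| ≤ B) (T : ℕ) :
    ∫ x, halfStatistic k T x ^ 2 ∂(iidLaw μ) = (∫ x, x ^ 2 ∂μ) *
      ∑ i ∈ Finset.range T, ∫ x, weightedSum k i x ^ 2 ∂(iidLaw μ) := by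
  induction T with
  | zero => simp [halfStatistic]
  | succ T ih =>
    have hMm := measurable_weightedSum hk T
    have hRm := measurable_halfStatistic hk T
    have hL := memLp_eval_mul_weightedSum h4 hk hB T T
    have hR := memLp_halfStatistic h4 hk hB T
    have e : ∀ x, halfStatistic k (T + 1) x ^ 2 = halfStatistic k T x ^ 2
        + (2 * (x T * (weightedSum k T x * halfStatistic k T x))
          + (x T * weightedSum k T x) ^ 2) := fun x => by
      rw [halfStatistic, Finset.sum_range_succ, ← halfStatistic]; ring
    have i1 : Integrable (fun x => x T * (weightedSum k T x * halfStatistic k T x)) (iidLaw μ) := by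
      refine (hL.integrable_mul hR).congr (ae_of_all _ fun x => ?_)
      simp only [Pi.mul_apply]; ring
    have z : ∫ x, x T * (weightedSum k T x * halfStatistic k T x) ∂(iidLaw μ) = 0 := by
      have hind := indepFun_eval_of_dependsOn μ (n := T)
        (F := fun x => weightedSum k T x * halfStatistic k T x) (hMm.mul hRm)
        (fun x y hxy => by
          simp only [dependsOn_weightedSum le_rfl hxy, dependsOn_halfStatistic T hxy])
      rw [hind.integral_fun_mul_eq_mul_integral (measurable_pi_apply T).aestronglyMeasurable
        (hMm.mul hRm).aestronglyMeasurable]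
      have : ∫ x : ℕ → ℝ, x T ∂(iidLaw μ) = 0 := by
        rw [← hm, ← integral_map (φ := fun x : ℕ → ℝ => x T) (f := fun y => y)
          (measurable_pi_apply T).aemeasurable (by fun_prop), map_eval]
      rw [this, zero_mul]
    have s : ∫ x, (x T * weightedSum k T x) ^ 2 ∂(iidLaw μ)
        = (∫ x, x ^ 2 ∂μ) * ∫ x, weightedSum k T x ^ 2 ∂(iidLaw μ) := by
      have hind := (indepFun_eval_of_dependsOn μ hMm (dependsOn_weightedSum le_rfl)).comp
        (φ := fun y : ℝ => y ^ 2) (ψ := fun y : ℝ => y ^ 2) (by fun_prop) (by fun_prop)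
      have := hind.integral_fun_mul_eq_mul_integral
        (((measurable_pi_apply T).pow_const 2).aestronglyMeasurable)
        ((hMm.pow_const 2).aestronglyMeasurable)
      simp only [mul_pow]
      refine this.trans ?_
      congr 1
      rw [← map_eval μ T, integral_map (measurable_pi_apply T).aemeasurable (by fun_prop), map_eval]
      rfl
    simp only [e]
    have i2 : Integrable (fun x => 2 * (x T * (weightedSum k T x * halfStatistic k T x))
        + (x T * weightedSum k T x) ^ 2) (iidLaw μ) := (i1.const_mul 2).add hL.integrable_sq
    rw [integral_add hR.integrable_sq i2,
      integral_add (i1.const_mul 2) hL.integrable_sq, integral_const_mul, z, s, ih,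
      Finset.sum_range_succ]
    ring

lemma integrable_cross (h4 : MemLp id 4 μ) (hk : Measurable k) (hB : ∀ y, |k y| ≤ B)
    (j l i : ℕ) : Integrable
      (fun x => (x j * k (blockSum j i x)) * (x l * k (blockSum l i x))) (iidLaw μ) :=
  ((memLp_eval_mul_kernel h4 hk hB j i).mono_exponent (p := 2) (by norm_num)).integrable_mul
    ((memLp_eval_mul_kernel h4 hk hB l i).mono_exponent (p := 2) (by norm_num))

lemma integral_sq_mul_kernel_sq_shift (hk : Measurable k) {j i : ℕ} (hji : j ≤ i) :
    ∫ x, (x j * k (blockSum j i x)) ^ 2 ∂(iidLaw μ)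
      = ∫ x, x 0 ^ 2 * k (blockSum 0 (i - j) x) ^ 2 ∂(iidLaw μ) := by
  have hm : Measurable fun x : ℕ → ℝ => x 0 ^ 2 * k (blockSum 0 (i - j) x) ^ 2 :=
    ((measurable_pi_apply 0).pow_const 2).mul
      ((hk.comp (measurable_blockSum 0 (i - j))).pow_const 2)
  rw [← integral_comp_injective μ (add_left_injective j) hm.aestronglyMeasurable]
  refine integral_congr_ae (ae_of_all _ fun x => ?_)
  have : blockSum 0 (i - j) (x ∘ fun l => l + j) = blockSum j i x := by
    simp only [blockSum, Function.comp_apply]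
    rw [Finset.sum_Ico_add' (fun l => x l)]
    simp [Nat.sub_add_cancel hji]
  simp only [this, Function.comp_apply, zero_add, mul_pow]

/-- By exchangeability the factor `x_j` may be replaced by the mean of its block, and so may `x_l`.
As the kernel confines both block sums to its support, the product is of the order of the squared
support radius over the block lengths. -/
lemma abs_integral_cross_le (h4 : MemLp id 4 μ) (hk : Measurable k) (hB : ∀ y, |k y| ≤ B)
    {r : ℝ} (hr0 : 0 ≤ r) (hr : ∀ y, k y ≠ 0 → |y| ≤ r) {j l i : ℕ} (hjl : j < l) (hli : l < i) :
    |∫ x, (x j * k (blockSum j i x)) * (x l * k (blockSum l i x)) ∂(iidLaw μ)|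
      ≤ 2 * r ^ 2 * B ^ 2 * ((((l - j : ℕ) : ℝ))⁻¹ * (((i - l : ℕ) : ℝ))⁻¹) := by
  have hB0 : 0 ≤ B := (abs_nonneg _).trans (hB 0)
  have hmk : ∀ a, Measurable fun x => k (blockSum a i x) := fun a =>
    hk.comp (measurable_blockSum a i)
  set G : (ℕ → ℝ) → ℝ := fun x => k (blockSum j i x) * k (blockSum l i x) with hG
  have hGm : Measurable G := (hmk j).mul (hmk l)
  have hGB : ∀ x, ‖G x‖ ≤ B ^ 2 := fun x => by
    rw [hG, Real.norm_eq_abs, abs_mul, sq]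
    exact mul_le_mul (hB _) (hB _) (abs_nonneg _) hB0
  have hpair : ∀ a b, Integrable (fun x : ℕ → ℝ => x a * x b) (iidLaw μ) := fun a b =>
    ((memLp_eval h4 a).mono_exponent (p := 2) (by norm_num)).integrable_mul
      ((memLp_eval h4 b).mono_exponent (p := 2) (by norm_num))
  have hpairG : ∀ a b, Integrable (fun x : ℕ → ℝ => x a * (x b * G x)) (iidLaw μ) := fun a b => by
    refine ((hpair a b).mul_bdd hGm.aestronglyMeasurable (ae_of_all _ hGB)).congr
      (ae_of_all _ fun x => ?_)
    simp only [mul_assoc]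
  have first := card_mul_integral_eval_mul μ (s := Finset.Ico j l) (j := j)
    (G := fun x => x l * G x) ((measurable_pi_apply l).mul hGm) (fun a ha x => by
      rw [Finset.mem_Ico] at ha
      have e1 : blockSum j i (x ∘ Equiv.swap j a) = blockSum j i x :=
        blockSum_comp_swap (by simp only [Finset.mem_Ico]; omega) x
      have e2 : blockSum l i (x ∘ Equiv.swap j a) = blockSum l i x :=
        blockSum_comp_swap (by simp only [Finset.mem_Ico]; omega) x
      simp only [hG, e1, e2, Function.comp_apply]
      rw [Equiv.swap_apply_of_ne_of_ne (by omega) (by omega)]) (fun a _ => hpairG a l)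
  have second := card_mul_integral_eval_mul μ (s := Finset.Ico l i) (j := l)
    (G := fun x => blockSum j l x * G x) ((measurable_blockSum j l).mul hGm) (fun a ha x => by
      rw [Finset.mem_Ico] at ha
      have e1 : blockSum j i (x ∘ Equiv.swap l a) = blockSum j i x :=
        blockSum_comp_swap (by simp only [Finset.mem_Ico]; omega) x
      have e2 : blockSum l i (x ∘ Equiv.swap l a) = blockSum l i x :=
        blockSum_comp_swap (by simp only [Finset.mem_Ico]; omega) x
      have e3 : blockSum j l (x ∘ Equiv.swap l a) = blockSum j l x :=
        blockSum_comp_swap (by simp only [Finset.mem_Ico]; omega) x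
      simp only [hG, e1, e2, e3]) (fun a _ => by
        have : (fun x : ℕ → ℝ => x a * (blockSum j l x * G x))
            = fun x => ∑ b ∈ Finset.Ico j l, x a * (x b * G x) := by
          ext x; rw [blockSum, Finset.sum_mul, Finset.mul_sum]
        rw [this]
        exact integrable_finsetSum _ fun b _ => hpairG a b)
  have e1 : ∫ x, (x j * k (blockSum j i x)) * (x l * k (blockSum l i x)) ∂(iidLaw μ)
      = ∫ x, x j * (x l * G x) ∂(iidLaw μ) :=
    integral_congr_ae (ae_of_all _ fun x => by simp only [hG]; ring)
  have e2 : ∫ x, (∑ a ∈ Finset.Ico j l, x a) * (x l * G x) ∂(iidLaw μ)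
      = ∫ x, x l * (blockSum j l x * G x) ∂(iidLaw μ) :=
    integral_congr_ae (ae_of_all _ fun x => by simp only [blockSum]; ring)
  have hbound : |∫ x, (∑ a ∈ Finset.Ico l i, x a) * (blockSum j l x * G x) ∂(iidLaw μ)|
      ≤ 2 * r ^ 2 * B ^ 2 := by
    rw [← Real.norm_eq_abs]
    refine (norm_integral_le_of_norm_le_const (C := 2 * r ^ 2 * B ^ 2)
      (ae_of_all _ fun x => ?_)).trans_eq (by simp)
    rw [← blockSum.eq_def l i x]
    by_cases hz : G x = 0
    · rw [hz, mul_zero, mul_zero, norm_zero]; positivity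
    · have h1 := hr _ (left_ne_zero_of_mul hz)
      have h2 := hr _ (right_ne_zero_of_mul hz)
      have h3 : blockSum j l x + blockSum l i x = blockSum j i x :=
        Finset.sum_Ico_consecutive _ hjl.le hli.le
      have h4 : |blockSum j l x| ≤ 2 * r := by
        rw [show blockSum j l x = blockSum j i x - blockSum l i x by linarith]
        exact (abs_sub _ _).trans (by linarith)
      rw [norm_mul, norm_mul, Real.norm_eq_abs, Real.norm_eq_abs]
      calc |blockSum l i x| * (|blockSum j l x| * ‖G x‖)
          ≤ r * ((2 * r) * B ^ 2) := by
            gcongr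
            exact hGB x
        _ = _ := by ring
  rw [e2] at first
  rw [e1]
  simp only [Nat.card_Ico] at first second
  have p1 : (0 : ℝ) < ((l - j : ℕ) : ℝ) := by exact_mod_cast Nat.sub_pos_of_lt hjl
  have p2 : (0 : ℝ) < ((i - l : ℕ) : ℝ) := by exact_mod_cast Nat.sub_pos_of_lt hli
  rw [← second, ← first, abs_mul, abs_mul, abs_of_pos p1, abs_of_pos p2] at hbound
  rw [← mul_inv, ← div_eq_mul_inv, le_div_iff₀ (by positivity)]
  linarith

lemma integral_weightedSum_sq (h4 : MemLp id 4 μ) (hk : Measurable k) (hB : ∀ y, |k y| ≤ B)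
    (i : ℕ) : ∫ x, weightedSum k i x ^ 2 ∂(iidLaw μ)
      = ∑ m ∈ Finset.range i, ∫ x, x 0 ^ 2 * k (blockSum 0 (m + 1) x) ^ 2 ∂(iidLaw μ)
        + 2 * ∑ l ∈ Finset.range i, ∑ j ∈ Finset.range l,
          ∫ x, (x j * k (blockSum j i x)) * (x l * k (blockSum l i x)) ∂(iidLaw μ) := by
  simp only [weightedSum, sq_sum_range]
  have hsq : ∀ j ∈ Finset.range i,
      Integrable (fun x => (x j * k (blockSum j i x)) ^ 2) (iidLaw μ) := fun j _ => by
    simpa only [sq] using integrable_cross h4 hk hB j j i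
  have hin : ∀ l ∈ Finset.range i, Integrable (fun x => ∑ j ∈ Finset.range l,
      (x j * k (blockSum j i x)) * (x l * k (blockSum l i x))) (iidLaw μ) := fun l _ =>
    integrable_finsetSum _ fun j _ => integrable_cross h4 hk hB j l i
  rw [integral_add (integrable_finsetSum _ hsq) ((integrable_finsetSum _ hin).const_mul 2),
    integral_const_mul, integral_finsetSum _ hsq, integral_finsetSum _ hin]
  refine congr_arg₂ (· + ·) ?_ (congr_arg (2 * ·) ?_)
  · rw [← Finset.sum_range_reflect]
    refine Finset.sum_congr rfl fun m hm => ?_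
    have := Finset.mem_range.1 hm
    rw [integral_sq_mul_kernel_sq_shift hk (by omega)]
    congr! 6
    omega
  · exact Finset.sum_congr rfl fun l _ =>
      integral_finsetSum _ fun j _ => integrable_cross h4 hk hB j l i

/-- The off-diagonal terms contribute at most the square of a harmonic sum. -/
lemma abs_integral_weightedSum_sq_sub_le (h4 : MemLp id 4 μ) (hk : Measurable k)
    (hB : ∀ y, |k y| ≤ B) {r : ℝ} (hr0 : 0 ≤ r) (hr : ∀ y, k y ≠ 0 → |y| ≤ r) {i T : ℕ}
    (hi : i ≤ T) :
    |∫ x, weightedSum k i x ^ 2 ∂(iidLaw μ)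
        - ∑ m ∈ Finset.range i, ∫ x, x 0 ^ 2 * k (blockSum 0 (m + 1) x) ^ 2 ∂(iidLaw μ)|
      ≤ 4 * r ^ 2 * B ^ 2 * (∑ m ∈ Finset.range T, ((m : ℝ) + 1)⁻¹) ^ 2 := by
  set H := ∑ m ∈ Finset.range T, ((m : ℝ) + 1)⁻¹ with hH
  have hmono : ∀ n ≤ T, ∑ m ∈ Finset.range n, (((n - m : ℕ) : ℝ))⁻¹ ≤ H := fun n hn => by
    rw [← Finset.sum_range_reflect]
    calc ∑ m ∈ Finset.range n, (((n - (n - 1 - m) : ℕ) : ℝ))⁻¹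
        = ∑ m ∈ Finset.range n, ((m : ℝ) + 1)⁻¹ := Finset.sum_congr rfl fun m hm => by
          have := Finset.mem_range.1 hm
          rw [show n - (n - 1 - m) = m + 1 by omega]
          push_cast; rfl
      _ ≤ H := Finset.sum_le_sum_of_subset_of_nonneg (Finset.range_mono hn)
          fun m _ _ => by positivity
  rw [integral_weightedSum_sq h4 hk hB, add_sub_cancel_left, abs_mul, abs_two]
  have hH0 : 0 ≤ H := Finset.sum_nonneg fun m _ => by positivity
  calc 2 * |∑ l ∈ Finset.range i, ∑ j ∈ Finset.range l,
          ∫ x, (x j * k (blockSum j i x)) * (x l * k (blockSum l i x)) ∂(iidLaw μ)|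
      ≤ 2 * ∑ l ∈ Finset.range i, ∑ j ∈ Finset.range l,
          2 * r ^ 2 * B ^ 2 * ((((l - j : ℕ) : ℝ))⁻¹ * (((i - l : ℕ) : ℝ))⁻¹) := by
        gcongr
        refine (Finset.abs_sum_le_sum_abs _ _).trans (Finset.sum_le_sum fun l hl => ?_)
        refine (Finset.abs_sum_le_sum_abs _ _).trans (Finset.sum_le_sum fun j hj => ?_)
        exact abs_integral_cross_le h4 hk hB hr0 hr (Finset.mem_range.1 hj) (Finset.mem_range.1 hl)
    _ = 4 * r ^ 2 * B ^ 2 * ∑ l ∈ Finset.range i,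
          (∑ j ∈ Finset.range l, (((l - j : ℕ) : ℝ))⁻¹) * (((i - l : ℕ) : ℝ))⁻¹ := by
        simp only [Finset.mul_sum, Finset.sum_mul]
        refine Finset.sum_congr rfl fun l _ => Finset.sum_congr rfl fun j _ => by ring
    _ ≤ 4 * r ^ 2 * B ^ 2 * (H * H) := by
        gcongr
        calc _ ≤ ∑ l ∈ Finset.range i, H * (((i - l : ℕ) : ℝ))⁻¹ := by
              refine Finset.sum_le_sum fun l hl => ?_
              gcongr
              exact hmono l ((Finset.mem_range.1 hl).le.trans hi)
          _ ≤ H * H := by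
              rw [← Finset.mul_sum]
              gcongr
              exact hmono i hi
    _ = _ := by ring

end Moments

/-! ### Diagonal terms -/

section Diagonal

variable {μ : Measure ℝ} [IsProbabilityMeasure μ] {f : ℝ → ℝ} {Q : ℝ → ℝ}

lemma integrable_eval_sq (h2 : Integrable (fun x : ℝ => x ^ 2) μ) (i : ℕ) :
    Integrable (fun x : ℕ → ℝ => x i ^ 2) (iidLaw μ) :=
  (measurePreserving_eval μ i).integrable_comp_of_integrable h2

/-- The characteristic function of `x₀ + ⋯ + x_n`, weighted by `x₀²`, factorises. -/
lemma integral_sq_mul_exp_blockSum (n : ℕ) (v : ℝ) :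
    ∫ x : ℕ → ℝ, ((x 0 ^ 2 : ℝ) : ℂ) * Complex.exp (v * blockSum 0 (n + 1) x * Complex.I)
      ∂(iidLaw μ) = sqCharFun μ v * charFun μ v ^ n := by
  induction n with
  | zero =>
    have e : ∀ x, blockSum 0 (0 + 1) x = x 0 := fun x => by simp [blockSum]
    simp only [e]
    rw [pow_zero, mul_one, sqCharFun, ← integral_map (φ := fun x : ℕ → ℝ => x 0)
      (f := fun y : ℝ => ((y ^ 2 : ℝ) : ℂ) * Complex.exp (v * y * Complex.I))
      (measurable_pi_apply 0).aemeasurable (by fun_prop), map_eval]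
  | succ n ih =>
    have hFm : Measurable fun x : ℕ → ℝ =>
        ((x 0 ^ 2 : ℝ) : ℂ) * Complex.exp (v * blockSum 0 (n + 1) x * Complex.I) := by fun_prop
    have hind := (indepFun_eval_of_dependsOn μ (n := n + 1) hFm (fun x y hxy => by
      simp only [dependsOn_blockSum le_rfl hxy, hxy 0 (Nat.succ_pos n)])).symm.comp
        (φ := id) (ψ := fun y : ℝ => Complex.exp (v * y * Complex.I)) measurable_id (by fun_prop)
    have h := hind.integral_fun_mul_eq_mul_integral
      hFm.aestronglyMeasurable (Measurable.aestronglyMeasurable (by fun_prop))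
    have e : ∫ x : ℕ → ℝ, Complex.exp (v * x (n + 1) * Complex.I) ∂(iidLaw μ) = charFun μ v := by
      rw [← integral_map (φ := fun x : ℕ → ℝ => x (n + 1))
        (f := fun y : ℝ => Complex.exp (v * y * Complex.I))
        (measurable_pi_apply _).aemeasurable (by fun_prop), map_eval, charFun_apply_real]
    rw [pow_succ, ← mul_assoc, ← ih, ← e]
    refine Eq.trans ?_ h
    refine integral_congr_ae (ae_of_all _ fun x => ?_)
    simp only [Function.comp_apply, id_eq]
    rw [mul_assoc ((x 0 ^ 2 : ℝ) : ℂ), ← Complex.exp_add]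
    congr 2
    rw [blockSum, Finset.sum_Ico_succ_top (Nat.zero_le _), ← blockSum]
    push_cast
    ring

/-- The last of the steps `x₀, …, x_n` is integrated out by `integral_comp_add_div`, the others by
`integral_sq_mul_exp_blockSum`. For `n = 0` the last step is also the one that carries the weight
`x₀²`, which is why `1 ≤ n` is required. -/
lemma integral_sq_mul_comp_blockSum (hf0 : ∀ x, 0 ≤ f x) (hfc : Continuous f)
    (hμ : μ = volume.withDensity (fun x => ENNReal.ofReal (f x)))
    (hψ : Integrable (charFun μ) volume) (h2 : Integrable (fun x : ℝ => x ^ 2) μ)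
    (hQm : Measurable Q) (hQ : Integrable Q volume) {B : ℝ} (hB : ∀ y, |Q y| ≤ B)
    {b : ℝ} (hb : 0 < b) {n : ℕ} (hn : 1 ≤ n) :
    ((∫ x, x 0 ^ 2 * Q (blockSum 0 (n + 1) x / b) ∂(iidLaw μ) : ℝ) : ℂ)
      = (b / (2 * Real.pi) : ℝ) •
        ∫ v, transform Q (b * v) * sqCharFun μ v * charFun μ v ^ n := by
  obtain ⟨m, rfl⟩ : ∃ m, n = m + 1 := ⟨n - 1, by omega⟩
  have hT := continuous_transform hQ
  have hsplit : ∀ x, blockSum 0 (m + 1 + 1) x = blockSum 0 (m + 1) x + x (m + 1) := fun x => by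
    rw [blockSum, Finset.sum_Ico_succ_top (Nat.zero_le _), ← blockSum]
  have hlast := integral_comp_eval_of_dependsOn μ (n := m + 1)
    (Y := fun x : ℕ → ℝ => (x 0, blockSum 0 (m + 1) x)) (by fun_prop)
    (fun x y hxy => by simp only [dependsOn_blockSum le_rfl hxy, hxy 0 (Nat.succ_pos m)])
    (F := fun p : (ℝ × ℝ) × ℝ => p.1.1 ^ 2 * Q ((p.1.2 + p.2) / b))
    (by refine Measurable.stronglyMeasurable ?_; fun_prop)
    ((integrable_eval_sq h2 0).mul_bdd (c := B) (by
      refine Measurable.aestronglyMeasurable ?_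
      fun_prop) (ae_of_all _ fun x => hB _))
  simp only at hlast
  simp only [hsplit]
  rw [hlast, ← integral_complex_ofReal]
  have hswap : Integrable (Function.uncurry fun (x : ℕ → ℝ) (v : ℝ) =>
      ((x 0 ^ 2 : ℝ) : ℂ) * (Complex.exp (v * blockSum 0 (m + 1) x * Complex.I) *
        (charFun μ v * transform Q (b * v)))) ((iidLaw μ).prod volume) := by
    have h1 : Integrable (fun v => charFun μ v * transform Q (b * v)) volume :=
      hψ.mul_bdd (c := ∫ z, |Q z|) (by fun_prop) (ae_of_all _ fun v => norm_transform_le _)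
    have h3 := (integrable_eval_sq h2 0).ofReal (𝕜 := ℂ).mul_prod h1
    have h4 := h3.bdd_mul (c := 1) (f := fun p : (ℕ → ℝ) × ℝ =>
      Complex.exp (p.2 * blockSum 0 (m + 1) p.1 * Complex.I)) (by fun_prop)
      (ae_of_all _ fun p => (norm_exp_mul_I p.2 (blockSum 0 (m + 1) p.1)).le)
    refine h4.congr (ae_of_all _ fun p => ?_)
    simp only [Function.uncurry, Complex.coe_algebraMap]
    ring
  calc ∫ x : ℕ → ℝ, ((∫ y, x 0 ^ 2 * Q ((blockSum 0 (m + 1) x + y) / b) ∂μ : ℝ) : ℂ) ∂(iidLaw μ)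
      = ∫ x : ℕ → ℝ, ((b / (2 * Real.pi) : ℝ) • ∫ v : ℝ, ((x 0 ^ 2 : ℝ) : ℂ) *
          (Complex.exp (v * blockSum 0 (m + 1) x * Complex.I) *
          (charFun μ v * transform Q (b * v)))) ∂(iidLaw μ) := by
        refine integral_congr_ae (ae_of_all _ fun x => ?_)
        simp only
        rw [integral_const_mul, Complex.ofReal_mul,
          integral_comp_add_div hf0 hfc hμ hψ hQ hb, mul_smul_comm, integral_const_mul]
    _ = (b / (2 * Real.pi) : ℝ) • ∫ v : ℝ, ∫ x : ℕ → ℝ, ((x 0 ^ 2 : ℝ) : ℂ) *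
          (Complex.exp (v * blockSum 0 (m + 1) x * Complex.I) *
          (charFun μ v * transform Q (b * v))) ∂(iidLaw μ) := by
        rw [integral_smul, integral_integral_swap hswap]
    _ = _ := by
        congr 1
        refine integral_congr_ae (ae_of_all _ fun v => ?_)
        simp only
        rw [pow_succ, show transform Q (b * v) * sqCharFun μ v * (charFun μ v ^ m * charFun μ v)
          = (sqCharFun μ v * charFun μ v ^ m) * (charFun μ v * transform Q (b * v)) by ring,
          ← integral_sq_mul_exp_blockSum, ← integral_mul_const]
        refine integral_congr_ae (ae_of_all _ fun x => ?_)
        simp only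
        ring

/-- The diagonal term `E[x₀² K²((x₀ + ⋯ + x_m) / b)]` of the second moment. -/
noncomputable def diagonalTerm (μ : Measure ℝ) [IsProbabilityMeasure μ] (K : ℝ → ℝ) (m : ℕ)
    (b : ℝ) : ℝ :=
  ∫ x, x 0 ^ 2 * K (blockSum 0 (m + 1) x / b) ^ 2 ∂(iidLaw μ)

variable {K : ℝ → ℝ} {B r : ℝ}

lemma diagonalTerm_nonneg (m : ℕ) (b : ℝ) : 0 ≤ diagonalTerm μ K m b :=
  integral_nonneg fun x => by positivity

lemma diagonalTerm_zero_le (hB : ∀ y, |K y| ≤ B) (hr0 : 0 ≤ r)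
    (hr : ∀ y, K y ≠ 0 → |y| ≤ r) {b : ℝ} (hb : 0 < b) : diagonalTerm μ K 0 b ≤ (r * b) ^ 2 * B ^ 2 := by
  refine (le_abs_self _).trans ?_
  rw [← Real.norm_eq_abs]
  refine (norm_integral_le_of_norm_le_const (C := (r * b) ^ 2 * B ^ 2)
      (ae_of_all _ fun x => ?_)).trans_eq (by simp)
  have e : blockSum 0 (0 + 1) x = x 0 := by simp [blockSum]
  rw [e, Real.norm_of_nonneg (by positivity)]
  by_cases hz : K (x 0 / b) = 0
  · rw [hz, zero_pow two_ne_zero, mul_zero]; positivity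
  · have h1 := hr _ hz
    rw [abs_div, abs_of_pos hb, div_le_iff₀ hb] at h1
    gcongr ?_ * ?_
    · exact sq_le_sq.2 (by rwa [abs_of_nonneg (by positivity : 0 ≤ r * b)])
    · exact sq_le_sq.2 ((hB _).trans (le_abs_self B))

lemma sq_le_of_abs_le (hB : ∀ y, |K y| ≤ B) (y : ℝ) : |K y ^ 2| ≤ B ^ 2 := by
  rw [abs_pow]
  exact pow_le_pow_left₀ (abs_nonneg _) (hB y) 2

/-- The diagonal terms are `O(b)` uniformly in `m`. -/
lemma exists_diagonalTerm_le (hf0 : ∀ x, 0 ≤ f x) (hfc : Continuous f)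
    (hμ : μ = volume.withDensity (fun x => ENNReal.ofReal (f x)))
    (hψ : Integrable (charFun μ) volume) (h2 : Integrable (fun x : ℝ => x ^ 2) μ)
    (hKm : Measurable K) (hK2 : Integrable (fun y => K y ^ 2) volume) (hB : ∀ y, |K y| ≤ B)
    (hr0 : 0 ≤ r) (hr : ∀ y, K y ≠ 0 → |y| ≤ r) :
    ∃ C, ∀ m b, 0 < b → b ≤ 1 → diagonalTerm μ K m b ≤ C * b := by
  set A := (∫ z, |K z ^ 2|) * ∫ x, x ^ 2 ∂μ with hA
  have hA0 : 0 ≤ A := mul_nonneg (integral_nonneg fun z => abs_nonneg _)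
    (integral_nonneg fun z => sq_nonneg _)
  have hI0 : 0 ≤ ∫ v, ‖charFun μ v‖ := integral_nonneg fun z => norm_nonneg _
  refine ⟨r ^ 2 * B ^ 2 + (2 * Real.pi)⁻¹ * (A * ∫ v, ‖charFun μ v‖),
    fun m b hb hb1 => ?_⟩
  rcases Nat.eq_zero_or_pos m with rfl | hm
  · have h1 := diagonalTerm_zero_le (μ := μ) hB hr0 hr hb
    have h3 : (r * b) ^ 2 * B ^ 2 ≤ r ^ 2 * B ^ 2 * b := by
      have : b ^ 2 ≤ b := by nlinarith
      calc (r * b) ^ 2 * B ^ 2 = r ^ 2 * B ^ 2 * b ^ 2 := by ring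
        _ ≤ _ := by gcongr
    have h4 : 0 ≤ (2 * Real.pi)⁻¹ * (A * ∫ v, ‖charFun μ v‖) * b := by positivity
    linarith
  · have h1 := integral_sq_mul_comp_blockSum hf0 hfc hμ hψ h2 (hKm.pow_const 2) hK2
      (sq_le_of_abs_le hB) hb hm
    have h3 : ‖∫ v, transform (fun y => K y ^ 2) (b * v) * sqCharFun μ v * charFun μ v ^ m‖
        ≤ A * ∫ v, ‖charFun μ v‖ := by
      rw [← integral_const_mul]
      refine norm_integral_le_of_norm_le (hψ.norm.const_mul A) (ae_of_all _ fun v => ?_)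
      refine (norm_transform_mul_sqCharFun_mul_pow_le b v m).trans ?_
      gcongr
      exact pow_le_of_le_one (norm_nonneg _) (norm_charFun_le_one v) (by omega)
    have h4 := congr_arg norm h1
    rw [Complex.norm_real, norm_smul,
      Real.norm_of_nonneg (by positivity : 0 ≤ b / (2 * Real.pi))] at h4
    change ‖diagonalTerm μ K m b‖ = _ at h4
    rw [Real.norm_of_nonneg (diagonalTerm_nonneg m b)] at h4
    rw [h4]
    have h5 : 0 ≤ r ^ 2 * B ^ 2 * b := by positivity
    calc b / (2 * Real.pi) * ‖_‖ ≤ b / (2 * Real.pi) * (A * ∫ v, ‖charFun μ v‖) := by gcongr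
      _ = (2 * Real.pi)⁻¹ * (A * ∫ v, ‖charFun μ v‖) * b := by ring
      _ ≤ _ := by linarith

/-- The local limit theorem for the diagonal terms: `x₀²` is asymptotically independent of the
event that the random walk at time `m + 1` is within distance of order `b` of the origin, and that
event contributes `(b / √m) ∫ K² / (σ √(2π))`, as `m → ∞` and `b → 0` jointly. -/
lemma tendsto_diagonalTerm (hf0 : ∀ x, 0 ≤ f x) (hfc : Continuous f) (hfs : ∀ x, f (-x) = f x)
    (hμ : μ = volume.withDensity (fun x => ENNReal.ofReal (f x)))
    (hψ : Integrable (charFun μ) volume) (hm : ∫ x, x ∂μ = 0) {σ : ℝ} (hσ : 0 < σ)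
    (h2i : Integrable (fun x : ℝ => x ^ 2) μ) (h2 : ∫ x, x ^ 2 ∂μ = σ ^ 2)
    (hKm : Measurable K) (hK2 : Integrable (fun y => K y ^ 2) volume) (hB : ∀ y, |K y| ≤ B) :
    Tendsto (fun p : ℕ × ℝ => √(p.1 : ℝ) * (diagonalTerm μ K p.1 p.2 / p.2)) (atTop ×ˢ 𝓝[>] 0)
      (𝓝 (σ * (∫ y, K y ^ 2) / √(2 * Real.pi))) := by
  have h := (tendsto_sqrt_mul_integral hf0 hfc hfs hμ hψ hK2 hm hσ h2i h2).const_mul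
    (((2 * Real.pi)⁻¹ : ℝ) : ℂ)
  have h' := (Complex.continuous_re.tendsto _).comp h
  have hs : √(2 * Real.pi) * √(2 * Real.pi) = 2 * Real.pi := Real.mul_self_sqrt (by positivity)
  have hs0 : 0 < √(2 * Real.pi) := by positivity
  have e : ((((2 * Real.pi)⁻¹ : ℝ) : ℂ) *
      ((((∫ y, K y ^ 2) * σ * √(2 * Real.pi) : ℝ)) : ℂ)).re
      = σ * (∫ y, K y ^ 2) / √(2 * Real.pi) := by
    rw [← Complex.ofReal_mul, Complex.ofReal_re]
    nth_rewrite 1 [← hs]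
    field_simp
  rw [e] at h'
  refine h'.congr' ?_
  have hn1 : ∀ᶠ p : ℕ × ℝ in atTop ×ˢ 𝓝[>] 0, 1 ≤ p.1 := (eventually_ge_atTop 1).prod_inl _
  have hb0 : ∀ᶠ p : ℕ × ℝ in atTop ×ˢ 𝓝[>] 0, 0 < p.2 :=
    (eventually_mem_nhdsWithin (a := (0 : ℝ)) (s := Set.Ioi 0)).prod_inr _
  filter_upwards [hn1, hb0] with p hp hb
  have h1 := integral_sq_mul_comp_blockSum hf0 hfc hμ hψ h2i (hKm.pow_const 2) hK2
      (sq_le_of_abs_le hB) hb hp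
  have h3 : (((√(p.1 : ℝ) * (diagonalTerm μ K p.1 p.2 / p.2)) : ℝ) : ℂ)
      = (((2 * Real.pi)⁻¹ : ℝ) : ℂ) * ((√(p.1 : ℝ) : ℂ) * ∫ v,
        transform (fun y => K y ^ 2) (p.2 * v) * sqCharFun μ v * charFun μ v ^ p.1) := by
    rw [diagonalTerm, Complex.ofReal_mul, Complex.ofReal_div, h1, Complex.real_smul]
    have : (p.2 : ℂ) ≠ 0 := by exact_mod_cast hb.ne'
    have : (Real.pi : ℂ) ≠ 0 := by exact_mod_cast Real.pi_ne_zero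
    push_cast
    field_simp
  rw [Function.comp_apply, ← h3, Complex.ofReal_re]

end Diagonal

/-! ### Asymptotics of the sums -/

section Sums

/-- As `0⁻¹ = 0`, the term `m = 0` of this sum vanishes. -/
lemma sum_inv_sqrt_bounds (i : ℕ) :
    2 * √(i : ℝ) - 2 ≤ ∑ m ∈ Finset.range i, (√(m : ℝ))⁻¹ ∧
      ∑ m ∈ Finset.range i, (√(m : ℝ))⁻¹ ≤ 2 * √(i : ℝ) := by
  have step : ∀ n : ℕ, √((n : ℝ) + 1) ^ 2 = √(n : ℝ) ^ 2 + 1 := fun n => by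
    rw [Real.sq_sqrt (by positivity), Real.sq_sqrt (by positivity)]
  constructor
  · induction i with
    | zero => simp
    | succ n ih =>
      rw [Finset.sum_range_succ]
      push_cast
      rcases Nat.eq_zero_or_pos n with rfl | hn
      · simp
      · have hx : 0 < √(n : ℝ) := Real.sqrt_pos.2 (by exact_mod_cast hn)
        have hy : 0 ≤ √((n : ℝ) + 1) := Real.sqrt_nonneg _
        have : 2 * (√((n : ℝ) + 1) - √(n : ℝ)) ≤ (√(n : ℝ))⁻¹ := by
          rw [← one_div, le_div_iff₀ hx]
          nlinarith [step n, sq_nonneg (√((n : ℝ) + 1) - √(n : ℝ))]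
        linarith
  · have h : ∀ n : ℕ, ∑ m ∈ Finset.range (n + 1), (√(m : ℝ))⁻¹ ≤ 2 * √(n : ℝ) := by
      intro n
      induction n with
      | zero => simp
      | succ n ih =>
        rw [Finset.sum_range_succ]
        push_cast
        have hx : 0 ≤ √(n : ℝ) := Real.sqrt_nonneg _
        have hy : 0 < √((n : ℝ) + 1) := by positivity
        have : (√((n : ℝ) + 1))⁻¹ ≤ 2 * (√((n : ℝ) + 1) - √(n : ℝ)) := by
          rw [← one_div, div_le_iff₀ hy]
          nlinarith [step n, sq_nonneg (√((n : ℝ) + 1) - √(n : ℝ))]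
        linarith
    refine le_trans ?_ (h i)
    rw [Finset.sum_range_succ]
    have : 0 ≤ (√(i : ℝ))⁻¹ := by positivity
    linarith

lemma sum_sqrt_bounds (T : ℕ) :
    2 / 3 * (T * √(T : ℝ)) - √(T : ℝ) ≤ ∑ i ∈ Finset.range T, √(i : ℝ) ∧
      ∑ i ∈ Finset.range T, √(i : ℝ) ≤ 2 / 3 * (T * √(T : ℝ)) := by
  induction T with
  | zero => simp
  | succ n ih =>
    rw [Finset.sum_range_succ]
    push_cast
    have hx : 0 ≤ √(n : ℝ) := Real.sqrt_nonneg _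
    have hy : 0 < √((n : ℝ) + 1) := by positivity
    have h1 : √(n : ℝ) ^ 2 = n := Real.sq_sqrt (by positivity)
    have h2 : √((n : ℝ) + 1) ^ 2 = n + 1 := Real.sq_sqrt (by positivity)
    have hxy : √(n : ℝ) ≤ √((n : ℝ) + 1) := Real.sqrt_le_sqrt (by linarith)
    generalize √(n : ℝ) = x at *
    generalize √((n : ℝ) + 1) = y at *
    rw [← h1] at h2 ih ⊢
    have e : (y - x) * (y + x) = 1 := by linarith
    have hlow : x ≤ 2 / 3 * ((x ^ 2 + 1) * y) - 2 / 3 * (x ^ 2 * x) := by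
      have : 2 / 3 * ((x ^ 2 + 1) * y) - 2 / 3 * (x ^ 2 * x) - x
          = (y - x) * (2 / 3 * (y ^ 2 + x * y + x ^ 2) - x * (y + x)) := by
        rw [← h2]; linear_combination x * e
      have h3 : 0 ≤ 2 / 3 * (y ^ 2 + x * y + x ^ 2) - x * (y + x) := by nlinarith
      have := mul_nonneg (sub_nonneg.2 hxy) h3
      linarith
    have hupp : 2 / 3 * ((x ^ 2 + 1) * y) - 2 / 3 * (x ^ 2 * x) ≤ y := by
      have : y - (2 / 3 * ((x ^ 2 + 1) * y) - 2 / 3 * (x ^ 2 * x))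
          = (y - x) * (y * (y + x) - 2 / 3 * (y ^ 2 + x * y + x ^ 2)) := by
        rw [← h2]; linear_combination -y * e
      have h3 : 0 ≤ y * (y + x) - 2 / 3 * (y ^ 2 + x * y + x ^ 2) := by nlinarith
      have := mul_nonneg (sub_nonneg.2 hxy) h3
      linarith
    constructor <;> linarith [ih.1, ih.2]

lemma double_sum_inv_sqrt_bounds (T : ℕ) :
    4 / 3 * (T * √(T : ℝ)) - 2 * √(T : ℝ) - 2 * T
        ≤ ∑ i ∈ Finset.range T, ∑ m ∈ Finset.range i, (√(m : ℝ))⁻¹ ∧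
      ∑ i ∈ Finset.range T, ∑ m ∈ Finset.range i, (√(m : ℝ))⁻¹ ≤ 4 / 3 * (T * √(T : ℝ)) := by
  have h := sum_sqrt_bounds T
  have h1 := Finset.sum_le_sum fun i (_ : i ∈ Finset.range T) => (sum_inv_sqrt_bounds i).1
  have h2 := Finset.sum_le_sum fun i (_ : i ∈ Finset.range T) => (sum_inv_sqrt_bounds i).2
  rw [Finset.sum_sub_distrib, ← Finset.mul_sum] at h1
  rw [← Finset.mul_sum] at h2
  simp only [Finset.sum_const, Finset.card_range, nsmul_eq_mul] at h1
  constructor <;> linarith [h.1, h.2]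

lemma tendsto_inv_sqrt_natCast : Tendsto (fun T : ℕ => (√(T : ℝ))⁻¹) atTop (𝓝 0) :=
  tendsto_inv_atTop_zero.comp (Real.tendsto_sqrt_atTop.comp tendsto_natCast_atTop_atTop)

lemma tendsto_double_sum_inv_sqrt :
    Tendsto (fun T : ℕ => (∑ i ∈ Finset.range T, ∑ m ∈ Finset.range i, (√(m : ℝ))⁻¹)
      / (T * √(T : ℝ))) atTop (𝓝 (4 / 3)) := by
  have hinv : Tendsto (fun T : ℕ => ((T : ℝ))⁻¹) atTop (𝓝 0) :=
    tendsto_inv_atTop_zero.comp tendsto_natCast_atTop_atTop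
  have hlow : Tendsto (fun T : ℕ => 4 / 3 - 2 * ((T : ℝ))⁻¹ - 2 * (√(T : ℝ))⁻¹) atTop
      (𝓝 (4 / 3)) := by
    simpa using ((hinv.const_mul 2).const_sub (4 / 3)).sub (tendsto_inv_sqrt_natCast.const_mul 2)
  refine tendsto_of_tendsto_of_tendsto_of_le_of_le' hlow tendsto_const_nhds ?_ ?_
  · filter_upwards [eventually_ge_atTop 1] with T hT
    have hT0 : (0 : ℝ) < T := by exact_mod_cast hT
    have hs : 0 < √(T : ℝ) := Real.sqrt_pos.2 hT0
    rw [le_div_iff₀ (by positivity)]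
    refine le_trans (le_of_eq ?_) (double_sum_inv_sqrt_bounds T).1
    field_simp
  · filter_upwards [eventually_ge_atTop 1] with T hT
    have hT0 : (0 : ℝ) < T := by exact_mod_cast hT
    rw [div_le_iff₀ (by positivity)]
    exact (double_sum_inv_sqrt_bounds T).2

/-- A joint limit `√m d(m, b) → L` is inherited by the double sums: the terms with small `m` are
bounded, and there are only `O(T)` of them. -/
lemma tendsto_double_sum_of_tendsto {d : ℕ → ℝ → ℝ} {L C : ℝ} {h : ℕ → ℝ}
    (hd : ∀ m b, 0 < b → b ≤ 1 → |d m b| ≤ C)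
    (hlim : Tendsto (fun p : ℕ × ℝ => √(p.1 : ℝ) * d p.1 p.2) (atTop ×ˢ 𝓝[>] 0) (𝓝 L))
    (hh : Tendsto h atTop (𝓝[>] 0)) :
    Tendsto (fun T : ℕ => (∑ i ∈ Finset.range T, ∑ m ∈ Finset.range i, d m (h T))
      / (T * √(T : ℝ))) atTop (𝓝 (4 / 3 * L)) := by
  have hmain := tendsto_double_sum_inv_sqrt.mul_const L
  -- It remains to compare `d m (h T)` with `L / √m`.
  suffices hdiff : Tendsto (fun T : ℕ => (∑ i ∈ Finset.range T, ∑ m ∈ Finset.range i,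
      (d m (h T) - L * (√(m : ℝ))⁻¹)) / (T * √(T : ℝ))) atTop (𝓝 0) by
    have := hmain.add hdiff
    rw [add_zero] at this
    refine this.congr fun T => ?_
    simp only [Finset.sum_sub_distrib, ← Finset.mul_sum]
    ring
  have hC : 0 ≤ C := (abs_nonneg _).trans (hd 0 1 one_pos le_rfl)
  rw [Metric.tendsto_atTop']
  intro ε hε
  have hev : ∀ᶠ p : ℕ × ℝ in atTop ×ˢ 𝓝[>] (0 : ℝ), |√(p.1 : ℝ) * d p.1 p.2 - L| < ε / 4 := by
    have := Metric.tendsto_nhds.1 hlim (ε / 4) (by positivity)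
    simpa only [Real.dist_eq] using this
  obtain ⟨pa, hpa, pb, hpb, hab⟩ := eventually_prod_iff.1 hev
  obtain ⟨N, hN⟩ := eventually_atTop.1 (hpa.and (eventually_ge_atTop 1))
  have hbT : ∀ᶠ T in atTop, pb (h T) := hh.eventually hpb
  have h01 : ∀ᶠ T in atTop, h T ∈ Set.Ioc (0 : ℝ) 1 := hh.eventually (Ioc_mem_nhdsGT one_pos)
  have hsmall : ∀ᶠ T : ℕ in atTop, (N * (C + |L|)) * (√(T : ℝ))⁻¹ < ε / 4 := by
    have := tendsto_inv_sqrt_natCast.const_mul (N * (C + |L|))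
    rw [mul_zero] at this
    exact this.eventually (gt_mem_nhds (by positivity))
  obtain ⟨T₀, hT₀⟩ := eventually_atTop.1 (((hbT.and h01).and hsmall).and (eventually_ge_atTop 1))
  refine ⟨T₀, fun T hT => ?_⟩
  obtain ⟨⟨⟨hpbT, hb0, hb1⟩, hs⟩, hT1⟩ := hT₀ T hT.le
  have hT0 : (0 : ℝ) < T := by exact_mod_cast hT1
  have hsT : 0 < √(T : ℝ) := Real.sqrt_pos.2 hT0
  have hterm : ∀ m : ℕ, |d m (h T) - L * (√(m : ℝ))⁻¹|
      ≤ ε / 4 * (√(m : ℝ))⁻¹ + if m < N then C + |L| else 0 := by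
    intro m
    split_ifs with hmN
    · have h1 : (√(m : ℝ))⁻¹ ≤ 1 := by
        rcases Nat.eq_zero_or_pos m with rfl | hm
        · simp
        · exact inv_le_one_of_one_le₀ (Real.one_le_sqrt.2 (by exact_mod_cast hm))
      have h0 : 0 ≤ (√(m : ℝ))⁻¹ := by positivity
      calc |d m (h T) - L * (√(m : ℝ))⁻¹| ≤ |d m (h T)| + |L * (√(m : ℝ))⁻¹| := abs_sub _ _
        _ ≤ C + |L| := by
          rw [abs_mul, abs_of_nonneg h0]
          have := hd m (h T) hb0 hb1
          nlinarith [abs_nonneg L]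
        _ ≤ _ := by
          have : 0 ≤ ε / 4 * (√(m : ℝ))⁻¹ := by positivity
          linarith
    · obtain ⟨h1, h2⟩ := hN m (not_lt.1 hmN)
      have hm0 : 0 < √(m : ℝ) := Real.sqrt_pos.2 (by exact_mod_cast h2)
      have h3 := (hab h1 hpbT).le
      simp only at h3
      rw [add_zero, show d m (h T) - L * (√(m : ℝ))⁻¹
        = (√(m : ℝ) * d m (h T) - L) * (√(m : ℝ))⁻¹ by field_simp, abs_mul,
        abs_of_nonneg (by positivity : 0 ≤ (√(m : ℝ))⁻¹)]
      gcongr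
  have hcount : ∀ i : ℕ, ∑ m ∈ Finset.range i, (if m < N then C + |L| else 0) ≤ N * (C + |L|) := by
    intro i
    rw [← Finset.sum_filter, Finset.sum_const, nsmul_eq_mul]
    gcongr
    calc ((Finset.range i).filter (· < N)).card ≤ (Finset.range N).card :=
          Finset.card_le_card fun m hm => by simpa using (Finset.mem_filter.1 hm).2
      _ = N := Finset.card_range N
  have htotal : |∑ i ∈ Finset.range T, ∑ m ∈ Finset.range i, (d m (h T) - L * (√(m : ℝ))⁻¹)|
      ≤ ε / 4 * (4 / 3 * (T * √(T : ℝ))) + T * (N * (C + |L|)) := by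
    calc _ ≤ ∑ i ∈ Finset.range T, (ε / 4 * ∑ m ∈ Finset.range i, (√(m : ℝ))⁻¹
          + N * (C + |L|)) := by
          refine (Finset.abs_sum_le_sum_abs _ _).trans (Finset.sum_le_sum fun i _ => ?_)
          refine (Finset.abs_sum_le_sum_abs _ _).trans
            ((Finset.sum_le_sum fun m _ => hterm m).trans ?_)
          rw [Finset.sum_add_distrib, ← Finset.mul_sum]
          gcongr
          exact hcount i
      _ = ε / 4 * ∑ i ∈ Finset.range T, ∑ m ∈ Finset.range i, (√(m : ℝ))⁻¹
          + T * (N * (C + |L|)) := by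
          rw [Finset.sum_add_distrib, ← Finset.mul_sum]
          simp
      _ ≤ _ := by
          gcongr
          exact (double_sum_inv_sqrt_bounds T).2
  rw [Real.dist_eq, sub_zero, abs_div, abs_of_pos (by positivity : 0 < T * √(T : ℝ)),
    div_lt_iff₀ (by positivity)]
  refine htotal.trans_lt ?_
  have : T * (N * (C + |L|)) < ε / 4 * (T * √(T : ℝ)) := by
    have h5 := mul_lt_mul_of_pos_right hs (by positivity : 0 < T * √(T : ℝ))
    have h6 : N * (C + |L|) * (√(T : ℝ))⁻¹ * (T * √(T : ℝ)) = T * (N * (C + |L|)) := by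
      field_simp
    rwa [h6] at h5
  have : 0 < ε * (T * √(T : ℝ)) := by positivity
  nlinarith

/-- The cross terms of the second moment are negligible against `T^{3/2} h`. -/
lemma tendsto_mul_sq_harmonic_div_sqrt {h : ℕ → ℝ} (hh : Tendsto h atTop (𝓝 0)) :
    Tendsto (fun T : ℕ => h T * ((∑ m ∈ Finset.range T, ((m : ℝ) + 1)⁻¹) ^ 2 / √(T : ℝ)))
      atTop (𝓝 0) := by
  have hlog : Tendsto (fun T : ℕ => (1 + Real.log T) ^ 2 / √(T : ℝ)) atTop (𝓝 0) := by
    have h1 : Tendsto (fun x : ℝ => Real.log x / x ^ (1 / 4 : ℝ)) atTop (𝓝 0) :=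
      (isLittleO_log_rpow_atTop (by norm_num)).tendsto_div_nhds_zero
    have h2 : Tendsto (fun x : ℝ => 1 / x ^ (1 / 4 : ℝ)) atTop (𝓝 0) :=
      tendsto_const_nhds.div_atTop (tendsto_rpow_atTop (by norm_num))
    have h3 := ((h2.add h1).pow 2).comp tendsto_natCast_atTop_atTop
    rw [add_zero, zero_pow two_ne_zero] at h3
    refine h3.congr fun T => ?_
    rw [Function.comp_apply, ← add_div, div_pow, ← Real.rpow_natCast (_ ^ _),
      ← Real.rpow_mul (Nat.cast_nonneg T), Real.sqrt_eq_rpow]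
    norm_num
  have hH : Tendsto (fun T : ℕ => (∑ m ∈ Finset.range T, ((m : ℝ) + 1)⁻¹) ^ 2 / √(T : ℝ))
      atTop (𝓝 0) := by
    refine squeeze_zero (fun T => by positivity) (fun T => ?_) hlog
    have := harmonic_le_one_add_log T
    rw [harmonic] at this
    push_cast at this
    gcongr
  simpa using hh.mul hH

end Sums

/-! ### Reduction to sequence space -/

section Statistic

/-- The double sum of a symmetric array without its diagonal is twice the sum below the diagonal. -/
lemma sum_sum_ne_of_symm {a : ℕ → ℕ → ℝ} (ha : ∀ i j, a i j = a j i) (T : ℕ) :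
    ∑ i ∈ Finset.range T, ∑ j ∈ Finset.range T, (if j ≠ i then a j i else 0)
      = 2 * ∑ i ∈ Finset.range T, ∑ j ∈ Finset.range i, a j i := by
  induction T with
  | zero => simp
  | succ T ih =>
    have h1 : ∑ i ∈ Finset.range T, (if T ≠ i then a T i else 0) = ∑ i ∈ Finset.range T, a i T :=
      Finset.sum_congr rfl fun i hi => by
        rw [if_pos (Finset.mem_range.1 hi).ne', ha]
    have h2 : ∑ j ∈ Finset.range T, (if j ≠ T then a j T else 0) = ∑ j ∈ Finset.range T, a j T :=
      Finset.sum_congr rfl fun j hj => if_pos (Finset.mem_range.1 hj).ne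
    simp only [Finset.sum_range_succ, Finset.sum_add_distrib, ih, h1, h2, ne_eq, not_true_eq_false,
      if_false]
    ring

variable {Ω : Type*} [MeasurableSpace Ω] {P : Measure Ω} {g : ℝ → ℝ} {u X : ℕ → Ω → ℝ}
  {K : ℝ → ℝ}

/-- Under the null hypothesis the process is the random walk with steps `u`. -/
lemma ae_eq_blockSum (hX : IsModel P g u X) (hH0 : NullHypothesis P g X) :
    ∀ᵐ ω ∂P, ∀ t, X t ω = blockSum 0 t fun i => u (i + 1) ω := by
  have hall : ∀ᵐ ω ∂P, ∀ t : ℕ, 1 ≤ t → X t ω = X (t - 1) ω + u t ω := by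
    refine ae_all_iff.2 fun t => ?_
    by_cases ht : 1 ≤ t
    · filter_upwards [hX.step t ht, hH0 t ht] with ω h1 h2 _
      rw [h1, h2]
    · exact ae_of_all _ fun ω h => absurd h ht
  filter_upwards [hX.init, hall] with ω h0 hω t
  induction t with
  | zero => simp [blockSum, h0]
  | succ t ih =>
    rw [hω (t + 1) (by omega), Nat.add_sub_cancel, ih, blockSum, blockSum,
      Finset.sum_Ico_succ_top (Nat.zero_le _)]

lemma statistic_ae_eq (hX : IsModel P g u X) (hH0 : NullHypothesis P g X)
    (hK : ∀ x, K (-x) = K x) (b : ℝ) (T : ℕ) :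
    ∀ᵐ ω ∂P, statistic K b u X T ω
      = 2 * halfStatistic (fun y => K (y / b)) T fun i => u (i + 1) ω := by
  filter_upwards [ae_eq_blockSum hX hH0] with ω hω
  have hIcc : ∀ F : ℕ → ℝ, ∑ t ∈ Finset.Icc 1 T, F t = ∑ i ∈ Finset.range T, F (i + 1) := by
    intro F
    rw [Finset.range_eq_Ico, Finset.sum_Ico_add' F]
    rfl
  have hsymm : ∀ i j : ℕ,
      u (i + 1) ω * K ((X j ω - X i ω) / b) * u (j + 1) ω
        = u (j + 1) ω * K ((X i ω - X j ω) / b) * u (i + 1) ω := fun i j => by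
    rw [← hK, ← neg_div, neg_sub]; ring
  have h := sum_sum_ne_of_symm
    (a := fun i j => u (i + 1) ω * K ((X j ω - X i ω) / b) * u (j + 1) ω) hsymm T
  rw [statistic]
  simp only [Finset.sum_filter, hIcc, Nat.add_sub_cancel, ne_eq, Nat.add_right_cancel_iff] at h ⊢
  rw [h, halfStatistic]
  congr 1
  refine Finset.sum_congr rfl fun i _ => ?_
  rw [weightedSum, Finset.mul_sum]
  refine Finset.sum_congr rfl fun j hj => ?_
  have : blockSum 0 i (fun i => u (i + 1) ω)
      = blockSum 0 j (fun i => u (i + 1) ω) + blockSum j i fun i => u (i + 1) ω :=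
    (Finset.sum_Ico_consecutive _ (Nat.zero_le j) (Finset.mem_range.1 hj).le).symm
  rw [hω, hω, this, add_sub_cancel_left]
  ring

end Statistic

end KernelUnitRoot

/-! ### The asymptotic variance -/

open KernelUnitRoot in
theorem theorem2p1 {Ω : Type*} [MeasurableSpace Ω] (P : Measure Ω) [IsProbabilityMeasure P]
    (g : ℝ → ℝ) (u X : ℕ → Ω → ℝ) (K : ℝ → ℝ) (h : ℕ → ℝ)
    (hu : KernelUnitRoot.ErrorAssumption P u)
    (hK : KernelUnitRoot.KernelAssumption K)
    (hh : KernelUnitRoot.BandwidthAssumption h)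
    (hX : KernelUnitRoot.IsModel P g u X)
    (hH0 : KernelUnitRoot.NullHypothesis P g X) :
    (∀ T : ℕ, Integrable (fun ω => (KernelUnitRoot.statistic K (h T) u X T ω) ^ 2) P) ∧
    (fun T : ℕ => KernelUnitRoot.sigmaSq P K h u X T) ~[atTop]
      (fun T : ℕ => KernelUnitRoot.constC10 P K u * (T : ℝ) ^ (3 / 2 : ℝ) * h T) := by
  have hu1 : Measurable (u 1) := hu.measurable 1 le_rfl
  have hum : ∀ i, Measurable (u (i + 1)) := fun i => hu.measurable (i + 1) (by omega)
  set μ := P.map (u 1) with hμdef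
  have : IsProbabilityMeasure μ := Measure.isProbabilityMeasure_map hu1.aemeasurable
  -- The errors, viewed as a random element of sequence space, have law `iidLaw μ`.
  set ξ : Ω → ℕ → ℝ := fun ω i => u (i + 1) ω with hξdef
  have hξ : Measurable ξ := measurable_pi_lambda _ hum
  have hlaw : P.map ξ = iidLaw μ := by
    rw [hu.indep.map_fun_eq_infinitePi_map hum]
    congr 1
    ext1 i
    exact (hu.identDistrib (i + 1) (by omega)).map_eq
  have hmp : MeasurePreserving ξ P (iidLaw μ) := ⟨hξ, hlaw⟩
  obtain ⟨f, hf0, hfs, hfd, -, hμ⟩ := hu.density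
  have hfc := hfd.continuous
  have hψ := integrable_charFun hu.charFun_integrable
  have h4 : MemLp id 4 μ := (memLp_map_measure_iff aestronglyMeasurable_id hu1.aemeasurable).2
    hu.memLp_four
  have h2i : Integrable (fun x : ℝ => x ^ 2) μ :=
    (h4.mono_exponent (p := 2) (by norm_num)).integrable_sq
  have hm : ∫ x, x ∂μ = 0 := by
    rw [hμdef, integral_map hu1.aemeasurable (by fun_prop), hu.mean_zero]
  have hsq : ∫ x, x ^ 2 ∂μ = ∫ ω, (u 1 ω) ^ 2 ∂P := by
    rw [hμdef, integral_map hu1.aemeasurable (by fun_prop)]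
  have hu2i : Integrable (fun ω => (u 1 ω) ^ 2) P :=
    (hu.memLp_four.mono_exponent (p := 2) (by norm_num)).integrable_sq
  have hu2pos : 0 < ∫ ω, (u 1 ω) ^ 2 ∂P := by
    refine (integral_nonneg fun ω => sq_nonneg _).lt_of_ne fun h0 => hu.fourth_moment_pos.ne' ?_
    rw [eq_comm, integral_eq_zero_iff_of_nonneg (fun ω => sq_nonneg _) hu2i] at h0
    refine integral_eq_zero_of_ae ?_
    filter_upwards [h0] with ω hω
    simp only [Pi.zero_apply] at hω ⊢
    rw [pow_eq_zero_iff two_ne_zero] at hω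
    simp [hω]
  have hσ : 0 < sigmaU P u := Real.sqrt_pos.2 hu2pos
  have hσ2 : ∫ x, x ^ 2 ∂μ = sigmaU P u ^ 2 := by
    rw [hsq, sigmaU, Real.sq_sqrt hu2pos.le]
  obtain ⟨c₁, c₂, c₃, hc₁, hc₂, hc₃, hbd⟩ := hK.bounds
  have hB0 : 0 ≤ c₃ := (hc₂.trans hc₃).le
  have hB : ∀ y, |K y| ≤ c₃ := fun y => by
    rw [abs_of_nonneg (hK.nonneg y)]
    refine (hbd y).2.trans (mul_le_of_le_one_right hB0 ?_)
    exact Set.indicator_apply_le' (fun _ => le_rfl) fun _ => zero_le_one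
  have hr : ∀ y, K y ≠ 0 → |y| ≤ c₁ := fun y hy => by
    by_contra hlt
    have hmem : y ∉ Set.Icc (-c₁) c₁ := fun hy' => hlt (abs_le.2 hy')
    have h1 := (hbd y).2
    rw [Set.indicator_of_notMem hmem, mul_zero] at h1
    exact hy (le_antisymm h1 (hK.nonneg y))
  have hK2 : Integrable (fun y => K y ^ 2) volume := by
    refine (hK.integrable.mul_bdd (c := c₃) hK.measurable.aestronglyMeasurable
      (ae_of_all _ hB)).congr (ae_of_all _ fun y => ?_)
    simp only [sq]
  have hK2pos : 0 < ∫ y, K y ^ 2 := by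
    refine (integral_nonneg fun ω => sq_nonneg _).lt_of_ne fun h0 =>
      one_ne_zero (hK.integral_eq_one.symm.trans ?_)
    rw [eq_comm, integral_eq_zero_iff_of_nonneg (fun ω => sq_nonneg _) hK2] at h0
    refine integral_eq_zero_of_ae ?_
    filter_upwards [h0] with y hy
    simpa using hy
  have hkm : ∀ b : ℝ, Measurable fun y => K (y / b) := fun b =>
    hK.measurable.comp (measurable_id.div_const b)
  have hae : ∀ T, (fun ω => statistic K (h T) u X T ω ^ 2)
      =ᵐ[P] fun ω => 4 * halfStatistic (fun y => K (y / h T)) T (ξ ω) ^ 2 := fun T => by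
    filter_upwards [statistic_ae_eq hX hH0 hK.symm (h T) T] with ω hω
    rw [hω]
    ring
  constructor
  · intro T
    refine Integrable.congr ?_ (hae T).symm
    exact (hmp.integrable_comp_of_integrable
      (memLp_halfStatistic h4 (hkm (h T)) (fun y => hB _) T).integrable_sq).const_mul 4
  have hσT : ∀ T, sigmaSq P K h u X T = 4 * (sigmaU P u ^ 2 * ∑ i ∈ Finset.range T,
      ∫ x, weightedSum (fun y => K (y / h T)) i x ^ 2 ∂(iidLaw μ)) := fun T => by
    rw [sigmaSq, integral_congr_ae (hae T), integral_const_mul, ← hσ2,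
      ← integral_halfStatistic_sq h4 hm (hkm (h T)) (fun y => hB _) T, ← hlaw,
      integral_map hξ.aemeasurable
      ((measurable_halfStatistic (hkm (h T)) T).pow_const 2).aestronglyMeasurable]
  have hh0 : Tendsto h atTop (𝓝 0) := by
    refine squeeze_zero' ?_ ?_ hh.upper
    · filter_upwards [eventually_ge_atTop 1] with T hT using (hh.pos T hT).le
    · filter_upwards [eventually_ge_atTop 1] with T hT
      refine le_mul_of_one_le_left (hh.pos T hT).le ?_
      exact Real.one_le_rpow (by exact_mod_cast hT) (by norm_num)
  have hhpos : Tendsto h atTop (𝓝[>] 0) := tendsto_nhdsWithin_iff.2 ⟨hh0, by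
    filter_upwards [eventually_ge_atTop 1] with T hT using hh.pos T hT⟩
  obtain ⟨C, hC⟩ := exists_diagonalTerm_le hf0 hfc hμ hψ h2i hK.measurable hK2 hB hc₁.le hr
  have hdiag := tendsto_double_sum_of_tendsto (d := fun m b => diagonalTerm μ K m b / b) (C := C)
    (fun m b hb hb1 => by
      rw [abs_of_nonneg (div_nonneg (diagonalTerm_nonneg m b) hb.le), div_le_iff₀ hb]
      exact hC m b hb hb1)
    (tendsto_diagonalTerm hf0 hfc hfs hμ hψ hm hσ h2i hσ2 hK.measurable hK2 hB) hhpos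
  have hoff : Tendsto (fun T : ℕ => (∑ i ∈ Finset.range T,
      (∫ x, weightedSum (fun y => K (y / h T)) i x ^ 2 ∂(iidLaw μ)
        - ∑ m ∈ Finset.range i, diagonalTerm μ K m (h T))) / (h T * (T * √(T : ℝ))))
      atTop (𝓝 0) := by
    have hbase := (tendsto_mul_sq_harmonic_div_sqrt hh0).const_mul (4 * c₁ ^ 2 * c₃ ^ 2)
    rw [mul_zero] at hbase
    refine squeeze_zero_norm' ?_ hbase
    filter_upwards [eventually_ge_atTop 1] with T hT
    have hb := hh.pos T hT
    have hT0 : (0 : ℝ) < T := by exact_mod_cast hT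
    have hsT : 0 < √(T : ℝ) := Real.sqrt_pos.2 hT0
    rw [norm_div, Real.norm_of_nonneg (by positivity : 0 ≤ h T * (T * √(T : ℝ))),
      div_le_iff₀ (by positivity), Real.norm_eq_abs]
    have hrb : ∀ y, K (y / h T) ≠ 0 → |y| ≤ c₁ * h T := fun y hy => by
      have := hr _ hy
      rwa [abs_div, abs_of_pos hb, div_le_iff₀ hb] at this
    calc _ ≤ ∑ i ∈ Finset.range T, 4 * (c₁ * h T) ^ 2 * c₃ ^ 2 *
          (∑ m ∈ Finset.range T, ((m : ℝ) + 1)⁻¹) ^ 2 := by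
          refine (Finset.abs_sum_le_sum_abs _ _).trans (Finset.sum_le_sum fun i hi => ?_)
          exact abs_integral_weightedSum_sq_sub_le h4 (hkm (h T)) (fun y => hB _)
            (by positivity) hrb (Finset.mem_range.1 hi).le
      _ = _ := by
          rw [Finset.sum_const, Finset.card_range, nsmul_eq_mul]
          field_simp
  have hlim : Tendsto (fun T : ℕ => sigmaSq P K h u X T / ((T : ℝ) ^ (3 / 2 : ℝ) * h T)) atTop
      (𝓝 (constC10 P K u)) := by
    have hsum := ((hdiag.add hoff).const_mul (4 * sigmaU P u ^ 2))
    have e : 4 * sigmaU P u ^ 2 * (4 / 3 * (sigmaU P u * (∫ y, K y ^ 2) / √(2 * Real.pi)) + 0)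
        = constC10 P K u := by
      rw [constC10]
      field_simp
      ring
    rw [e] at hsum
    refine hsum.congr' ?_
    filter_upwards [eventually_ge_atTop 1] with T hT
    have hb := hh.pos T hT
    have hT0 : (0 : ℝ) < T := by exact_mod_cast hT
    have hsT : 0 < √(T : ℝ) := Real.sqrt_pos.2 hT0
    have hpow : (T : ℝ) ^ (3 / 2 : ℝ) = T * √(T : ℝ) := by
      rw [Real.sqrt_eq_rpow, ← Real.rpow_one_add' hT0.le (by norm_num)]
      norm_num
    rw [hσT, hpow]
    simp only [← Finset.sum_div, Finset.sum_sub_distrib]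
    field_simp
    ring
  have hC10 : constC10 P K u ≠ 0 := by
    rw [constC10]
    positivity
  refine (isEquivalent_iff_tendsto_one ?_).2 ?_
  · filter_upwards [eventually_ge_atTop 1] with T hT
    have hT0 : (0 : ℝ) < T := by exact_mod_cast hT
    exact mul_ne_zero (mul_ne_zero hC10 (by positivity)) (hh.pos T hT).ne'
  · have := hlim.div_const (constC10 P K u)
    rw [div_self hC10] at this
    refine this.congr fun T => ?_
    rw [Pi.div_apply, div_div, mul_comm _ (constC10 P K u), mul_assoc]
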